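/- Let $p\in(0,1)$ be a constant, and let $G_p\in\mathcal G_{n,p}$ be the Erdős–Rényi random graph on $n$ vertices, in which each of the $\binom n2$ possible edges is present independently with probability $p$. For a connected graph $G$ with vertex set $\{1,\dots,n\}$, let $D(i,j)$ be the distance between the vertices $i$ and $j$, let $D(G)$ be the diameter of $G$, and let $RCW(G)$ be the reciprocal complementary Wiener matrix of $G$, that is, the real symmetric $n\times n$ matrix with $$RCW(G)(i,j)=\frac{1}{D(G)+1-D(i,j)}\quad (i\neq j),\qquad RCW(G)(i,i)=0 .$$ The energy $\mathscr E(M)$ of a real symmetric matrix $M$ is the sum of the absolute values of its eigenvalues, counted with multiplicity. Then $$\mathscr E(RCW(G_p))=\Bigl(\frac{4}{3\pi}\sqrt{p(1-p)}+o(1)\Bigr)\,n^{3/2}\quad\text{a.s.},$$ where "a.s." means "with probability tending to $1$ as $n\to\infty$"; that is, for every $\varepsilon>0$, the probability that $G_p$ is connected and $$\Bigl|\mathscr E(RCW(G_p))-\frac{4}{3\pi}\sqrt{p(1-p)}\;n^{3/2}\Bigr|\le \varepsilon\, n^{3/2}$$ tends to $1$ as $n\to\infty$. -/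

import Mathlib

open MeasureTheory Filter Topology

/-- The reciprocal complementary Wiener matrix of a graph: zero on the diagonal, and
`1 / (diam G + 1 - dist i j)`, computed in the real numbers, off the diagonal.
(For a disconnected graph, distances and the diameter are not all finite and the matrix has no
mathematical meaning.) -/
noncomputable def rcwMatrix {V : Type*} [DecidableEq V] (G : SimpleGraph V) : Matrix V V ℝ :=
  Matrix.of fun i j => if i = j then 0 else 1 / ((G.diam : ℝ) + 1 - (G.dist i j : ℝ))

theorem rcwMatrix_isHermitian {V : Type*} [DecidableEq V] (G : SimpleGraph V) :
    (rcwMatrix G).IsHermitian := by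
  refine Matrix.IsHermitian.ext fun i j => ?_
  simp [rcwMatrix, eq_comm, SimpleGraph.dist_comm]

/-- The energy of a real symmetric matrix: the sum of the absolute values of its eigenvalues,
counted with multiplicity. -/
noncomputable def matrixEnergy {V : Type*} [Fintype V] [DecidableEq V] {A : Matrix V V ℝ}
    (hA : A.IsHermitian) : ℝ :=
  ∑ i, |hA.eigenvalues i|

section Spectral

variable {V : Type*} [Fintype V] [DecidableEq V]

open Matrix

theorem Matrix.IsHermitian.exists_orthogonal_diagonalization {A : Matrix V V ℝ}
    (hA : A.IsHermitian) :
    ∃ U : Matrix V V ℝ, U * Uᵀ = 1 ∧ Uᵀ * U = 1 ∧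
      A = U * Matrix.diagonal hA.eigenvalues * Uᵀ := by
  refine ⟨hA.eigenvectorUnitary, ?_, ?_, ?_⟩
  · simpa [star_eq_conjTranspose] using Unitary.mul_star_self_of_mem hA.eigenvectorUnitary.2
  · simpa [star_eq_conjTranspose] using Unitary.star_mul_self_of_mem hA.eigenvectorUnitary.2
  · have h := hA.spectral_theorem
    simpa [Unitary.conjStarAlgAut_apply, star_eq_conjTranspose, Function.comp_def] using h

theorem sum_abs_diag_conj_le_matrixEnergy {Y U : Matrix V V ℝ} (hY : Y.IsHermitian)
    (hU : U * Uᵀ = 1) : ∑ i, |(Uᵀ * Y * U) i i| ≤ matrixEnergy hY := by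
  obtain ⟨W, -, hW, hYW⟩ := hY.exists_orthogonal_diagonalization
  set Q := Uᵀ * W with hQ
  have hQQ : Qᵀ * Q = 1 := by
    rw [hQ, transpose_mul, transpose_transpose, Matrix.mul_assoc, ← Matrix.mul_assoc U, hU,
      Matrix.one_mul, hW]
  have hconj : Uᵀ * Y * U = Q * diagonal hY.eigenvalues * Qᵀ := by
    conv_lhs => rw [hYW]
    simp only [hQ, transpose_mul, transpose_transpose, Matrix.mul_assoc]
  have hent (i : V) : (Uᵀ * Y * U) i i = ∑ k, hY.eigenvalues k * Q i k ^ 2 := by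
    rw [hconj, Matrix.mul_apply]
    refine Finset.sum_congr rfl fun k _ => ?_
    rw [Matrix.mul_diagonal, transpose_apply]; ring
  have hcol (k : V) : ∑ i, Q i k ^ 2 = 1 := by
    have := congrFun (congrFun hQQ k) k
    simpa [Matrix.mul_apply, sq] using this
  calc ∑ i, |(Uᵀ * Y * U) i i| ≤ ∑ i, ∑ k, |hY.eigenvalues k| * Q i k ^ 2 := by
        refine Finset.sum_le_sum fun i _ => ?_
        rw [hent]
        refine (Finset.abs_sum_le_sum_abs _ _).trans (le_of_eq ?_)
        simp [abs_mul]
    _ = ∑ k, |hY.eigenvalues k| * ∑ i, Q i k ^ 2 := by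
        rw [Finset.sum_comm]; simp [Finset.mul_sum]
    _ = matrixEnergy hY := by simp [hcol, matrixEnergy]

/-- The energy changes by at most `2 |c| n` under the addition of `c (J - I)`. -/
theorem matrixEnergy_le_of_eq_add {X Y : Matrix V V ℝ} (hX : X.IsHermitian) (hY : Y.IsHermitian)
    (κ c : ℝ) (h : X = κ • Y + c • ((Matrix.of fun _ _ => (1 : ℝ) : Matrix V V ℝ) - 1)) :
    matrixEnergy hX ≤ |κ| * matrixEnergy hY + 2 * |c| * Fintype.card V := by
  obtain ⟨U, hU, hU', hXU⟩ := hX.exists_orthogonal_diagonalization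
  have hdiag : Uᵀ * X * U = diagonal hX.eigenvalues := by
    conv_lhs => rw [hXU]
    simp only [Matrix.mul_assoc, hU', Matrix.mul_one]
    rw [← Matrix.mul_assoc, hU', Matrix.one_mul]
  have hJ (i : V) : (Uᵀ * (Matrix.of fun _ _ => (1 : ℝ) : Matrix V V ℝ) * U) i i = (∑ a, U a i) ^ 2 := by
    simp [Matrix.mul_apply, sq, Finset.mul_sum, Finset.sum_mul]
  have hsumJ : ∑ i, (∑ a, U a i) ^ 2 = Fintype.card V := by
    have h1 (i : V) : (∑ a, U a i) ^ 2 = ∑ a, ∑ b, U a i * U b i := by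
      rw [sq, Finset.sum_mul_sum]
    simp_rw [h1]
    rw [Finset.sum_comm]
    have h2 (a b : V) : ∑ i, U a i * U b i = (1 : Matrix V V ℝ) a b := by
      rw [← hU]; simp [Matrix.mul_apply]
    calc _ = ∑ a, ∑ b, ∑ i, U a i * U b i := by
          refine Finset.sum_congr rfl fun a _ => Finset.sum_comm
      _ = _ := by simp [h2, Matrix.one_apply]
  have hent (i : V) : hX.eigenvalues i
      = κ * (Uᵀ * Y * U) i i + c * ((∑ a, U a i) ^ 2 - 1) := by
    have h1 : (Uᵀ * X * U) i i = hX.eigenvalues i := by rw [hdiag]; simp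
    rw [← h1, h, Matrix.mul_add, Matrix.add_mul, Matrix.mul_smul, Matrix.smul_mul,
      Matrix.mul_smul, Matrix.smul_mul, Matrix.mul_sub, Matrix.sub_mul, Matrix.mul_one, hU']
    simp only [Matrix.add_apply, Matrix.smul_apply, Matrix.sub_apply, hJ, smul_eq_mul,
      Matrix.one_apply_eq]
  calc matrixEnergy hX = ∑ i, |hX.eigenvalues i| := rfl
    _ ≤ ∑ i, (|κ| * |(Uᵀ * Y * U) i i| + |c| * ((∑ a, U a i) ^ 2 + 1)) := by
        refine Finset.sum_le_sum fun i _ => ?_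
        rw [hent i]
        refine (abs_add_le _ _).trans ?_
        rw [abs_mul, abs_mul]
        gcongr
        exact (abs_sub _ _).trans (by simp)
    _ = |κ| * ∑ i, |(Uᵀ * Y * U) i i| + 2 * |c| * Fintype.card V := by
        rw [Finset.sum_add_distrib, ← Finset.mul_sum, ← Finset.mul_sum, Finset.sum_add_distrib,
          hsumJ]
        simp; ring
    _ ≤ _ := by
        gcongr
        exact sum_abs_diag_conj_le_matrixEnergy hY hU

theorem Matrix.IsHermitian.sum_sq_eigenvalues {A : Matrix V V ℝ} (hA : A.IsHermitian) :
    ∑ k, hA.eigenvalues k ^ 2 = ∑ i, ∑ j, A i j ^ 2 := by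
  obtain ⟨U, hU, hU', hAU⟩ := hA.exists_orthogonal_diagonalization
  have h1 : ∑ i, ∑ j, A i j ^ 2 = (A * Aᵀ).trace := by
    simp [Matrix.trace, Matrix.mul_apply, sq]
  have hT : Aᵀ = A := by simpa [Matrix.IsHermitian] using hA.eq
  have h2 : A * A = U * diagonal (fun k => hA.eigenvalues k ^ 2) * Uᵀ := by
    nth_rewrite 1 [hAU]
    nth_rewrite 2 [hAU]
    rw [show U * diagonal hA.eigenvalues * Uᵀ * (U * diagonal hA.eigenvalues * Uᵀ)
      = U * diagonal hA.eigenvalues * (Uᵀ * U) * diagonal hA.eigenvalues * Uᵀ by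
        simp only [Matrix.mul_assoc], hU', Matrix.mul_one, Matrix.mul_assoc U, diagonal_mul_diagonal]
    simp [sq]
  rw [h1, hT, h2, Matrix.trace_mul_comm, ← Matrix.mul_assoc, hU', Matrix.one_mul, trace_diagonal]

/-- The resolvent `(A - iη)⁻¹` of a real symmetric matrix exists, is symmetric, has rows of
`ℓ²`-norm at most `1 / η`, and has the trace given by the eigenvalues. -/
theorem Matrix.IsHermitian.exists_resolvent {A : Matrix V V ℝ} (hA : A.IsHermitian) {η : ℝ}
    (hη : 0 < η) :
    ∃ R : Matrix V V ℂ,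
      (A.map (fun x : ℝ => (x : ℂ)) - (Complex.I * η) • (1 : Matrix V V ℂ)) * R = 1 ∧
      (∀ i j, R i j = R j i) ∧ (∀ i, ∑ j, ‖R i j‖ ^ 2 ≤ (1 / η) ^ 2) ∧
      R.trace.im = ∑ k, η / (hA.eigenvalues k ^ 2 + η ^ 2) := by
  obtain ⟨U, hU, hU', hAU⟩ := hA.exists_orthogonal_diagonalization
  set l := hA.eigenvalues with hl
  set z : V → ℂ := fun k => (l k : ℂ) - Complex.I * η with hz
  have hz0 (k : V) : z k ≠ 0 := by
    intro h
    have := congrArg Complex.im h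
    simp [hz] at this
    exact hη.ne' this
  set C : Matrix V V ℂ := U.map (fun x : ℝ => (x : ℂ)) with hC
  have hCC : C * Cᵀ = 1 := by
    have := congrArg (fun M : Matrix V V ℝ => M.map (Complex.ofRealHom)) hU
    simp only [Matrix.map_mul, Matrix.transpose_map, Matrix.map_one, map_zero, map_one] at this
    exact this
  have hCC' : Cᵀ * C = 1 := mul_eq_one_comm.mp hCC
  have hM : A.map (fun x : ℝ => (x : ℂ)) - (Complex.I * η) • (1 : Matrix V V ℂ)
      = C * diagonal z * Cᵀ := by
    have h1 : A.map (fun x : ℝ => (x : ℂ)) = C * diagonal (fun k => (l k : ℂ)) * Cᵀ := by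
      have := congrArg (fun M : Matrix V V ℝ => M.map (Complex.ofRealHom)) hAU
      simp only [Matrix.map_mul, Matrix.transpose_map, Matrix.diagonal_map, map_zero] at this
      exact this
    have h2 : (Complex.I * η) • (1 : Matrix V V ℂ)
        = C * diagonal (fun _ => Complex.I * η) * Cᵀ := by
      rw [← Matrix.smul_one_eq_diagonal, Matrix.mul_smul, Matrix.mul_one, Matrix.smul_mul, hCC]
    rw [h1, h2, ← Matrix.sub_mul, ← Matrix.mul_sub, diagonal_sub]
  refine ⟨C * diagonal (fun k => (z k)⁻¹) * Cᵀ, ?_, ?_, ?_, ?_⟩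
  · rw [hM, show C * diagonal z * Cᵀ * (C * diagonal (fun k => (z k)⁻¹) * Cᵀ)
      = C * diagonal z * (Cᵀ * C) * diagonal (fun k => (z k)⁻¹) * Cᵀ by
        simp only [Matrix.mul_assoc], hCC', Matrix.mul_one, Matrix.mul_assoc C,
        diagonal_mul_diagonal]
    simp [hz0, hCC]
  · intro i j
    have : (C * diagonal (fun k => (z k)⁻¹) * Cᵀ)ᵀ = C * diagonal (fun k => (z k)⁻¹) * Cᵀ := by
      simp [Matrix.transpose_mul, Matrix.mul_assoc]
    exact (congrFun (congrFun this j) i)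
  · intro i
    set R := C * diagonal (fun k => (z k)⁻¹) * Cᵀ with hR
    have hstar : star C = Cᵀ := by
      ext a b; simp [hC, star_apply]
    have hstar' : Cᵀᴴ = C := by
      ext a b; simp [hC]
    have h1 : R * Rᴴ = C * diagonal (fun k => ((‖z k‖⁻¹ ^ 2 : ℝ) : ℂ)) * Cᵀ := by
      rw [hR, conjTranspose_mul, conjTranspose_mul, hstar', diagonal_conjTranspose,
        ← star_eq_conjTranspose, hstar,
        show C * diagonal (fun k => (z k)⁻¹) * Cᵀ *
          (C * (diagonal (star fun k => (z k)⁻¹) * Cᵀ))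
        = C * diagonal (fun k => (z k)⁻¹) * (Cᵀ * C) * diagonal (star fun k => (z k)⁻¹) * Cᵀ by
          simp only [Matrix.mul_assoc], hCC', Matrix.mul_one, Matrix.mul_assoc C,
        diagonal_mul_diagonal]
      congr 3
      ext k
      simp only [Pi.star_apply, RCLike.star_def]
      rw [Complex.mul_conj']
      simp
    have h2 : ((∑ j, ‖R i j‖ ^ 2 : ℝ) : ℂ) = (R * Rᴴ) i i := by
      simp [Matrix.mul_apply, Complex.mul_conj']
    have h3 : (R * Rᴴ) i i = ((∑ k, U i k ^ 2 * ‖z k‖⁻¹ ^ 2 : ℝ) : ℂ) := by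
      rw [h1, Matrix.mul_apply]
      push_cast
      refine Finset.sum_congr rfl fun k _ => ?_
      rw [Matrix.mul_diagonal]
      simp [hC]; ring
    have h4 : ∑ j, ‖R i j‖ ^ 2 = ∑ k, U i k ^ 2 * ‖z k‖⁻¹ ^ 2 := by
      exact_mod_cast h2.trans h3
    rw [h4]
    have hrow : ∑ k, U i k ^ 2 = 1 := by
      have := congrFun (congrFun hU i) i
      simpa [Matrix.mul_apply, sq] using this
    calc ∑ k, U i k ^ 2 * ‖z k‖⁻¹ ^ 2 ≤ ∑ k, U i k ^ 2 * (1 / η) ^ 2 := by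
          refine Finset.sum_le_sum fun k _ => ?_
          have : η ≤ ‖z k‖ := by
            have := Complex.abs_im_le_norm (z k)
            simpa [hz, abs_of_pos hη] using this
          gcongr
          rw [← one_div]
          gcongr
      _ = _ := by rw [← Finset.sum_mul, hrow, one_mul]
  · rw [Matrix.trace_mul_comm, ← Matrix.mul_assoc, hCC', Matrix.one_mul, trace_diagonal,
      Complex.im_sum]
    refine Finset.sum_congr rfl fun k _ => ?_
    rw [Complex.inv_im]
    simp [hz, Complex.normSq_apply, sq]

end Spectral

section RandomGraph

open SimpleGraph

variable {V : Type*} [Fintype V] [DecidableEq V]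

/-- The probability of a graph under the binomial random graph law. -/
noncomputable def graphWeight (p : unitInterval) (G : SimpleGraph V) : ℝ :=
  (binomialRandom V p).real {G}

theorem graphWeight_nonneg (p : unitInterval) (G : SimpleGraph V) : 0 ≤ graphWeight p G :=
  measureReal_nonneg

theorem graphWeight_eq (p : unitInterval) (G : SimpleGraph V) :
    graphWeight p G = (p : ℝ) ^ G.edgeSet.ncard *
      (1 - (p : ℝ)) ^ ((Fintype.card V).choose 2 - G.edgeSet.ncard) := by
  rw [graphWeight, measureReal_def, binomialRandom_singleton]
  simp

instance : MeasurableSingletonClass (SimpleGraph V) where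
  measurableSet_singleton G := by
    have h : ({G} : Set (SimpleGraph V)) = edgeSet ⁻¹' {G.edgeSet} := by
      ext; simp
    rw [h]
    exact measurable_edgeSet (measurableSet_singleton _)

open scoped Classical in
theorem binomialRandom_real_eq_sum (p : unitInterval) (S : Set (SimpleGraph V)) :
    (binomialRandom V p).real S = ∑ G, if G ∈ S then graphWeight p G else 0 := by
  have h : S = ((Finset.univ.filter (· ∈ S) : Finset (SimpleGraph V)) : Set (SimpleGraph V)) := by
    ext; simp
  rw [← Finset.sum_filter]
  conv_lhs => rw [h]
  rw [← sum_measureReal_singleton]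
  rfl

theorem sum_graphWeight (p : unitInterval) : ∑ G : SimpleGraph V, graphWeight p G = 1 := by
  classical
  have h := binomialRandom_real_eq_sum p (Set.univ : Set (SimpleGraph V))
  simpa using h.symm

theorem ncard_edgeSet_sdiff_edge {G : SimpleGraph V} {i j : V} (h : G.Adj i j) :
    G.edgeSet.ncard = (G \ edge i j).edgeSet.ncard + 1 := by
  have h1 : (G \ edge i j).edgeSet = G.edgeSet \ {s(i, j)} := by
    rw [edgeSet_sdiff, edgeSet_edge_of_ne h.ne]
  rw [h1, Set.ncard_sdiff_singleton_add_one (by simpa using h)]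

theorem ncard_edgeSet_le (G : SimpleGraph V) :
    G.edgeSet.ncard ≤ (Fintype.card V).choose 2 := by
  classical
  have := G.card_edgeFinset_le_card_choose_two
  rwa [← Set.ncard_coe_finset, coe_edgeFinset] at this

theorem graphWeight_mul_eq {p : unitInterval} {G : SimpleGraph V} {i j : V} (h : G.Adj i j) :
    graphWeight p G * (1 - p) = graphWeight p (G \ edge i j) * p := by
  have h1 := ncard_edgeSet_sdiff_edge h
  have h2 := ncard_edgeSet_le G
  rw [graphWeight_eq, graphWeight_eq]
  obtain ⟨m, hm⟩ := Nat.exists_eq_add_of_le h2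
  have h3 : (Fintype.card V).choose 2 - G.edgeSet.ncard = m := by omega
  have h4 : (Fintype.card V).choose 2 - (G \ edge i j).edgeSet.ncard = m + 1 := by omega
  rw [h3, h4, h1]
  ring

/-- Resampling a single edge does not change expectations. -/
theorem sum_graphWeight_resample {M : Type*} [AddCommGroup M] [Module ℝ M] (p : unitInterval)
    {i j : V} (hij : i ≠ j) (F : SimpleGraph V → M) :
    ∑ G, graphWeight p G • F G = ∑ G, graphWeight p G •
      ((p : ℝ) • F (G ⊔ edge i j) + (1 - (p : ℝ)) • F (G \ edge i j)) := by
  classical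
  have hsup {G : SimpleGraph V} (h : G.Adj i j) : G ⊔ edge i j = G :=
    sup_eq_left.mpr ((edge_le_iff _).mpr (Or.inr h))
  have hsdiff {G : SimpleGraph V} (h : ¬ G.Adj i j) : G \ edge i j = G :=
    sdiff_eq_left.mpr (by rwa [disjoint_edge])
  have hse {G : SimpleGraph V} (h : G.Adj i j) : (G \ edge i j) ⊔ edge i j = G := by
    rw [sdiff_sup_cancel ((edge_le_iff _).mpr (Or.inr h))]
  have hes {G : SimpleGraph V} (h : ¬ G.Adj i j) : (G ⊔ edge i j) \ edge i j = G := by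
    rw [sup_sdiff_right_self, hsdiff h]
  have hnot (G : SimpleGraph V) : ¬ (G \ edge i j).Adj i j := by
    simp [sdiff_adj, edge_adj, hij]
  have hadj (G : SimpleGraph V) : (G ⊔ edge i j).Adj i j := by
    simp [edge_adj, hij]
  rw [← sub_eq_zero, ← Finset.sum_sub_distrib]
  refine Finset.sum_involution
    (fun G _ => if G.Adj i j then G \ edge i j else G ⊔ edge i j) ?_ ?_ (by simp) ?_
  · intro G _
    have key (G : SimpleGraph V) (h : G.Adj i j) :
        (graphWeight p G • F G - graphWeight p G •
          ((p : ℝ) • F (G ⊔ edge i j) + (1 - (p : ℝ)) • F (G \ edge i j))) +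
        (graphWeight p (G \ edge i j) • F (G \ edge i j) - graphWeight p (G \ edge i j) •
          ((p : ℝ) • F ((G \ edge i j) ⊔ edge i j) +
            (1 - (p : ℝ)) • F ((G \ edge i j) \ edge i j))) = 0 := by
      rw [hsup h, hse h, hsdiff (hnot G)]
      have hw := graphWeight_mul_eq (p := p) h
      have e : (graphWeight p G • F G - graphWeight p G •
          ((p : ℝ) • F G + (1 - (p : ℝ)) • F (G \ edge i j))) +
        (graphWeight p (G \ edge i j) • F (G \ edge i j) - graphWeight p (G \ edge i j) •
          ((p : ℝ) • F G + (1 - (p : ℝ)) • F (G \ edge i j))) =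
        (graphWeight p G * (1 - p) - graphWeight p (G \ edge i j) * p) •
          (F G - F (G \ edge i j)) := by module
      rw [e, hw, sub_self, zero_smul]
    by_cases h : G.Adj i j
    · simp only [h, if_true]
      exact key G h
    · simp only [h, if_false]
      have := key (G ⊔ edge i j) (hadj G)
      rw [add_comm]
      simpa only [hes h] using this
  · intro G _ _
    by_cases h : G.Adj i j
    · simp only [h, if_true]
      intro e
      exact hnot G (by rwa [e])
    · simp only [h, if_false]
      intro e
      exact h (by rw [← e]; exact hadj G)
  · intro G _
    by_cases h : G.Adj i j
    · simp [h, hnot, hse]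
    · simp only [h, if_false, hadj, if_true, hes h]

open scoped Classical in
/-- The indicator of adjacency. -/
noncomputable def adjIndicator {V : Type*} (G : SimpleGraph V) (i j : V) : ℝ :=
  if G.Adj i j then 1 else 0

theorem adjIndicator_of_adj {G : SimpleGraph V} {i j : V} (h : G.Adj i j) :
    adjIndicator G i j = 1 := if_pos h

theorem adjIndicator_of_not_adj {G : SimpleGraph V} {i j : V} (h : ¬ G.Adj i j) :
    adjIndicator G i j = 0 := if_neg h

theorem adjIndicator_congr {G G' : SimpleGraph V} {a b c d : V} (h : G.Adj a b ↔ G'.Adj c d) :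
    adjIndicator G a b = adjIndicator G' c d := by
  by_cases h1 : G.Adj a b
  · rw [adjIndicator_of_adj h1, adjIndicator_of_adj (h.mp h1)]
  · rw [adjIndicator_of_not_adj h1, adjIndicator_of_not_adj (mt h.mpr h1)]

theorem adjIndicator_comm (G : SimpleGraph V) (i j : V) :
    adjIndicator G i j = adjIndicator G j i :=
  adjIndicator_congr (G.adj_comm i j)

theorem adjIndicator_sup_edge {i j : V} (hij : i ≠ j) (G : SimpleGraph V) :
    adjIndicator (G ⊔ edge i j) i j = 1 :=
  adjIndicator_of_adj (by simp [edge_adj, hij])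

theorem adjIndicator_sdiff_edge {i j : V} (hij : i ≠ j) (G : SimpleGraph V) :
    adjIndicator (G \ edge i j) i j = 0 :=
  adjIndicator_of_not_adj (by simp [sdiff_adj, edge_adj, hij])

theorem adjIndicator_sup_edge_of_ne {i j a b : V} (h : s(a, b) ≠ s(i, j)) (G : SimpleGraph V) :
    adjIndicator (G ⊔ edge i j) a b = adjIndicator G a b := by
  have : (G ⊔ edge i j).Adj a b ↔ G.Adj a b := by
    simp only [sup_adj, edge_adj]; simp only [ne_eq, Sym2.eq_iff] at h; tauto
  exact adjIndicator_congr this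

theorem adjIndicator_sdiff_edge_of_ne {i j a b : V} (h : s(a, b) ≠ s(i, j))
    (G : SimpleGraph V) :
    adjIndicator (G \ edge i j) a b = adjIndicator G a b := by
  have : (G \ edge i j).Adj a b ↔ G.Adj a b := by
    simp only [sdiff_adj, edge_adj]; simp only [ne_eq, Sym2.eq_iff] at h; tauto
  exact adjIndicator_congr this

/-- Discrete integration by parts in a single edge indicator. -/
theorem sum_graphWeight_mul_indicator_sub (p : unitInterval) {i j : V} (hij : i ≠ j)
    (F : SimpleGraph V → ℂ) :
    ∑ G, (graphWeight p G : ℂ) * ((adjIndicator G i j - (p : ℝ) : ℝ) * F G) =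
      ∑ G, (graphWeight p G : ℂ) *
        (((p * (1 - p) : ℝ) : ℂ) * (F (G ⊔ edge i j) - F (G \ edge i j))) := by
  have h := sum_graphWeight_resample p hij
    (fun G => ((adjIndicator G i j - (p : ℝ) : ℝ) : ℂ) * F G)
  simp only [Complex.real_smul] at h
  rw [h]
  refine Finset.sum_congr rfl fun G _ => ?_
  rw [adjIndicator_sup_edge hij, adjIndicator_sdiff_edge hij]
  push_cast
  ring

theorem sum_graphWeight_prod_no_common_neighbor (p : unitInterval) {i j : V} (hij : i ≠ j)
    (S : Finset V) (hi : i ∉ S) (hj : j ∉ S) :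
    ∑ G : SimpleGraph V, graphWeight p G *
      ∏ k ∈ S, (1 - adjIndicator G i k * adjIndicator G j k) = (1 - (p : ℝ) ^ 2) ^ S.card := by
  induction S using Finset.induction_on with
  | empty => simp [sum_graphWeight]
  | insert k S hk ih =>
    simp only [Finset.mem_insert, not_or] at hi hj
    specialize ih hi.2 hj.2
    simp only [Finset.prod_insert hk, Finset.card_insert_of_notMem hk]
    set P : SimpleGraph V → ℝ := fun G =>
      ∏ k ∈ S, (1 - adjIndicator G i k * adjIndicator G j k) with hP
    have hik : i ≠ k := hi.1
    have hjk : j ≠ k := hj.1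
    have inv (x : V) (hx : x = i ∨ x = j) (G : SimpleGraph V) :
        P (G ⊔ edge x k) = P G ∧ P (G \ edge x k) = P G := by
      have hne (l : V) (hl : l ∈ S) : s(i, l) ≠ s(x, k) ∧ s(j, l) ≠ s(x, k) := by
        have hl1 : l ≠ k := fun e => hk (e ▸ hl)
        simp only [ne_eq, Sym2.eq_iff]
        tauto
      constructor <;> refine Finset.prod_congr rfl fun l hl => ?_
      · rw [adjIndicator_sup_edge_of_ne (hne l hl).1, adjIndicator_sup_edge_of_ne (hne l hl).2]
      · rw [adjIndicator_sdiff_edge_of_ne (hne l hl).1, adjIndicator_sdiff_edge_of_ne (hne l hl).2]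
    have hne : s(j, k) ≠ s(i, k) := by
      simp only [ne_eq, Sym2.eq_iff]; tauto
    have r1 := sum_graphWeight_resample p hik (fun G : SimpleGraph V =>
      (1 - adjIndicator G i k * adjIndicator G j k) * P G)
    have r2 := sum_graphWeight_resample p hjk (fun G : SimpleGraph V =>
      (1 - (p : ℝ) * adjIndicator G j k) * P G)
    simp only [smul_eq_mul] at r1 r2
    rw [r1, pow_succ, ← ih, Finset.sum_mul]
    trans ∑ G, graphWeight p G * ((1 - (p : ℝ) * adjIndicator G j k) * P G)
    · refine Finset.sum_congr rfl fun G _ => ?_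
      rw [(inv i (Or.inl rfl) G).1, (inv i (Or.inl rfl) G).2, adjIndicator_sup_edge hik,
        adjIndicator_sdiff_edge hik, adjIndicator_sup_edge_of_ne hne]
      ring
    · rw [r2]
      refine Finset.sum_congr rfl fun G _ => ?_
      rw [(inv j (Or.inr rfl) G).1, (inv j (Or.inr rfl) G).2, adjIndicator_sup_edge hjk,
        adjIndicator_sdiff_edge hjk]
      ring

theorem binomialRandom_real_no_common_neighbor_le (p : unitInterval) {i j : V} (hij : i ≠ j) :
    (binomialRandom V p).real {G | ∀ k, ¬ (G.Adj i k ∧ G.Adj j k)} ≤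
      (1 - (p : ℝ) ^ 2) ^ (Fintype.card V - 2) := by
  classical
  have h := sum_graphWeight_prod_no_common_neighbor p hij ({i, j}ᶜ : Finset V) (by simp) (by simp)
  rw [Finset.card_compl, Finset.card_pair hij] at h
  rw [← h, binomialRandom_real_eq_sum]
  refine Finset.sum_le_sum fun G _ => ?_
  split_ifs with hG
  · refine le_of_eq ?_
    rw [Finset.prod_eq_one, mul_one]
    intro k _
    have := hG k
    by_cases h1 : G.Adj i k
    · rw [adjIndicator_of_not_adj (fun h2 => this ⟨h1, h2⟩)]; simp
    · rw [adjIndicator_of_not_adj h1]; simp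
  · refine mul_nonneg (graphWeight_nonneg _ _) (Finset.prod_nonneg fun k _ => ?_)
    simp only [adjIndicator]
    split_ifs <;> simp

/-- Graphs that are not complete and in which any two vertices have a common neighbor. -/
def commonNeighborGraphs (V : Type*) : Set (SimpleGraph V) :=
  {G | G ≠ ⊤ ∧ ∀ i j, i ≠ j → ∃ k, G.Adj i k ∧ G.Adj j k}

theorem binomialRandom_real_compl_commonNeighborGraphs_le (p : unitInterval) :
    (binomialRandom V p).real (commonNeighborGraphs V)ᶜ ≤
      (p : ℝ) ^ (Fintype.card V).choose 2 +
        (Fintype.card V : ℝ) ^ 2 * (1 - (p : ℝ) ^ 2) ^ (Fintype.card V - 2) := by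
  have hp : 0 ≤ 1 - (p : ℝ) ^ 2 := by
    have := p.2.1; have := p.2.2; nlinarith
  have hsub : (commonNeighborGraphs V)ᶜ ⊆ {(⊤ : SimpleGraph V)} ∪
      ⋃ x : V × V, {G : SimpleGraph V | x.1 ≠ x.2 ∧ ∀ k, ¬ (G.Adj x.1 k ∧ G.Adj x.2 k)} := by
    intro G hG
    by_contra hcon
    simp only [Set.mem_union, Set.mem_singleton_iff, Set.mem_iUnion, Set.mem_ofPred_eq,
      Prod.exists, not_or, not_exists, not_and, not_forall, not_not] at hcon
    refine hG ⟨hcon.1, fun i j hij => ?_⟩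
    obtain ⟨k, hk, hk'⟩ := hcon.2 i j hij
    exact ⟨k, hk, hk'⟩
  refine (measureReal_mono hsub).trans ((measureReal_union_le _ _).trans ?_)
  gcongr
  · have : (binomialRandom V p).real {(⊤ : SimpleGraph V)} = graphWeight p ⊤ := rfl
    have hc : (⊤ : SimpleGraph V).edgeSet.ncard = (Fintype.card V).choose 2 := by
      classical
      rw [← card_edgeFinset_top_eq_card_choose_two, ← Set.ncard_coe_finset, coe_edgeFinset]
    rw [this, graphWeight_eq, hc]
    simp
  · refine (measureReal_iUnion_fintype_le _).trans ?_
    calc _ ≤ ∑ x : V × V, (1 - (p : ℝ) ^ 2) ^ (Fintype.card V - 2) := by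
          refine Finset.sum_le_sum fun x _ => ?_
          by_cases hx : x.1 = x.2
          · simp [hx]; positivity
          · simpa [hx] using binomialRandom_real_no_common_neighbor_le p hx
      _ = _ := by simp [sq]

theorem tendsto_binomialRandom_real_compl_commonNeighborGraphs {p : unitInterval}
    (hp0 : 0 < (p : ℝ)) (hp1 : (p : ℝ) < 1) :
    Tendsto (fun n : ℕ => (binomialRandom (Fin n) p).real (commonNeighborGraphs (Fin n))ᶜ)
      atTop (𝓝 0) := by
  have hr0 : 0 < 1 - (p : ℝ) ^ 2 := by nlinarith
  have hr1 : 1 - (p : ℝ) ^ 2 < 1 := by nlinarith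
  have h1 : Tendsto (fun n : ℕ => (p : ℝ) ^ n.choose 2) atTop (𝓝 0) := by
    refine (tendsto_pow_atTop_nhds_zero_of_lt_one hp0.le hp1).comp ?_
    refine tendsto_atTop_mono' atTop (f₁ := fun n : ℕ => n - 1) ?_ (tendsto_sub_atTop_nat 1)
    filter_upwards [eventually_ge_atTop 2] with n hn
    rw [Nat.choose_two_right, Nat.le_div_iff_mul_le two_pos, mul_comm]
    exact Nat.mul_le_mul_right _ hn
  have h2 : Tendsto (fun n : ℕ => (n : ℝ) ^ 2 * (1 - (p : ℝ) ^ 2) ^ (n - 2)) atTop (𝓝 0) := by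
    have := (tendsto_pow_const_mul_const_pow_of_abs_lt_one 2
      (by rwa [abs_of_pos hr0] : |1 - (p : ℝ) ^ 2| < 1)).mul_const (((1 - (p : ℝ) ^ 2) ^ 2)⁻¹)
    rw [zero_mul] at this
    refine this.congr' ?_
    filter_upwards [eventually_ge_atTop 2] with n hn
    rw [pow_sub₀ _ hr0.ne' hn, mul_assoc]
  refine squeeze_zero (fun n => measureReal_nonneg)
    (fun n => binomialRandom_real_compl_commonNeighborGraphs_le p) ?_
  simpa using h1.add h2

theorem connected_of_mem_commonNeighborGraphs [Nontrivial V] {G : SimpleGraph V}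
    (hG : G ∈ commonNeighborGraphs V) : G.Connected := by
  refine (connected_iff _).mpr ⟨fun i j => ?_, inferInstance⟩
  by_cases hij : i = j
  · exact hij ▸ Reachable.refl _
  · obtain ⟨k, hk, hk'⟩ := hG.2 i j hij
    exact hk.reachable.trans hk'.symm.reachable

/-- On a graph of diameter two, the reciprocal complementary Wiener matrix is `J - I - A / 2`. -/
theorem rcwMatrix_apply_of_mem_commonNeighborGraphs [Nontrivial V] {G : SimpleGraph V}
    (hG : G ∈ commonNeighborGraphs V) {i j : V} (hij : i ≠ j) :
    rcwMatrix G i j = 1 - adjIndicator G i j / 2 := by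
  have hconn := connected_of_mem_commonNeighborGraphs hG
  have hdist (i j : V) : G.dist i j ≤ 2 := by
    by_cases hij : i = j
    · simp [hij]
    · obtain ⟨k, hk, hk'⟩ := hG.2 i j hij
      exact dist_le (Walk.cons hk (Walk.cons hk'.symm Walk.nil))
  have hdist' {i j : V} (hij : i ≠ j) (h : ¬ G.Adj i j) : G.dist i j = 2 := by
    have h0 : G.dist i j ≠ 0 := by
      rw [Ne, hconn.dist_eq_zero_iff]; exact hij
    have h1 : G.dist i j ≠ 1 := by
      rw [Ne, dist_eq_one_iff_adj]; exact h
    have := hdist i j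
    omega
  have hdiam : G.diam = 2 := by
    have h0 : G.diam ≠ 0 := connected_iff_diam_ne_zero.mp hconn
    have h1 : G.diam ≠ 1 := by rw [Ne, diam_eq_one]; exact hG.1
    obtain ⟨u, v, huv⟩ := G.exists_dist_eq_diam
    have := hdist u v
    omega
  rw [rcwMatrix, Matrix.of_apply, if_neg hij, hdiam]
  by_cases h : G.Adj i j
  · rw [dist_eq_one_iff_adj.mpr h, adjIndicator_of_adj h]; norm_num
  · rw [hdist' hij h, adjIndicator_of_not_adj h]; norm_num

end RandomGraph

section Resolvent

variable {V : Type*} [Fintype V] [DecidableEq V]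

/-- The resolvent `(A - iη)⁻¹` of a real matrix on the imaginary axis. -/
noncomputable def imResolvent (A : Matrix V V ℝ) (η : ℝ) : Matrix V V ℂ :=
  (A.map (fun x : ℝ => (x : ℂ)) - (Complex.I * η) • (1 : Matrix V V ℂ))⁻¹

theorem imResolvent_spec {A : Matrix V V ℝ} (hA : A.IsHermitian) {η : ℝ} (hη : 0 < η) :
    (A.map (fun x : ℝ => (x : ℂ)) - (Complex.I * η) • (1 : Matrix V V ℂ)) * imResolvent A η = 1 ∧
      (∀ i j, imResolvent A η i j = imResolvent A η j i) ∧
      (∀ i, ∑ j, ‖imResolvent A η i j‖ ^ 2 ≤ (1 / η) ^ 2) ∧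
      (imResolvent A η).trace.im = ∑ k, η / (hA.eigenvalues k ^ 2 + η ^ 2) := by
  obtain ⟨R, h1, h2⟩ := hA.exists_resolvent hη
  have : imResolvent A η = R := Matrix.inv_eq_right_inv h1
  rw [this]
  exact ⟨h1, h2⟩

theorem imResolvent_sub {A B : Matrix V V ℝ} (hA : A.IsHermitian) (hB : B.IsHermitian) {η : ℝ}
    (hη : 0 < η) :
    imResolvent A η - imResolvent B η
      = -(imResolvent A η * (A - B).map (fun x : ℝ => (x : ℂ)) * imResolvent B η) := by
  have h1 := mul_eq_one_comm.mp (imResolvent_spec hA hη).1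
  have h2 := (imResolvent_spec hB hη).1
  set MA := A.map (fun x : ℝ => (x : ℂ)) - (Complex.I * η) • (1 : Matrix V V ℂ) with hMA
  set MB := B.map (fun x : ℝ => (x : ℂ)) - (Complex.I * η) • (1 : Matrix V V ℂ) with hMB
  have h3 : (A - B).map (fun x : ℝ => (x : ℂ)) = MA - MB := by
    ext i j; simp [hMA, hMB]
  rw [h3, Matrix.mul_sub, Matrix.sub_mul, h1, Matrix.one_mul, Matrix.mul_assoc, h2, Matrix.mul_one]
  abel

/-- The normalized trace. -/
noncomputable def normTrace (R : Matrix V V ℂ) : ℂ := R.trace / Fintype.card V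

/-- The defect in the self-consistent equation `1 + iη g + σ g² = 0` of the semicircle law of
variance `σ` at the point `iη`, for `g` the normalized trace of `R`. -/
noncomputable def semicircleDefect (η σ : ℝ) (R : Matrix V V ℂ) : ℂ :=
  1 + Complex.I * η * normTrace R + σ * normTrace R ^ 2

theorem norm_apply_le_of_row {R : Matrix V V ℂ} {a : ℝ} (ha : 0 ≤ a)
    (hR : ∀ i, ∑ j, ‖R i j‖ ^ 2 ≤ a ^ 2) (i j : V) : ‖R i j‖ ≤ a := by
  refine (sq_le_sq₀ (norm_nonneg _) ha).mp ?_
  exact (Finset.single_le_sum (f := fun j => ‖R i j‖ ^ 2) (fun _ _ => by positivity)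
    (Finset.mem_univ j)).trans (hR i)

theorem norm_normTrace_le {R : Matrix V V ℂ} {a : ℝ} (ha : 0 ≤ a)
    (hR : ∀ i, ∑ j, ‖R i j‖ ^ 2 ≤ a ^ 2) : ‖normTrace R‖ ≤ a := by
  rw [normTrace, norm_div, Complex.norm_natCast]
  refine div_le_of_le_mul₀ (by positivity) ha ?_
  calc ‖R.trace‖ ≤ ∑ i, ‖R i i‖ := norm_sum_le _ _
    _ ≤ ∑ _i : V, a := Finset.sum_le_sum fun i _ => norm_apply_le_of_row ha hR i i
    _ = a * Fintype.card V := by simp [mul_comm]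

theorem norm_semicircleDefect_le {R : Matrix V V ℂ} {η σ a : ℝ} (hη : 0 ≤ η) (hσ : 0 ≤ σ)
    (ha : 0 ≤ a) (hR : ∀ i, ∑ j, ‖R i j‖ ^ 2 ≤ a ^ 2) :
    ‖semicircleDefect η σ R‖ ≤ 1 + η * a + σ * a ^ 2 := by
  have h := norm_normTrace_le ha hR
  refine (norm_add_le _ _).trans (add_le_add ((norm_add_le _ _).trans ?_) ?_)
  · simp only [norm_one, norm_mul, Complex.norm_I, Complex.norm_real, Real.norm_eq_abs,
      abs_of_nonneg hη, one_mul]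
    gcongr
  · simp only [norm_mul, Complex.norm_real, Real.norm_eq_abs, abs_of_nonneg hσ, norm_pow]
    gcongr

theorem norm_normTrace_sub_le {X Y : Matrix V V ℂ} {i j : V} {θ a : ℝ}
    (hXs : ∀ a b, X a b = X b a) (hX : ∀ i, ∑ j, ‖X i j‖ ^ 2 ≤ a ^ 2)
    (hY : ∀ i, ∑ j, ‖Y i j‖ ^ 2 ≤ a ^ 2) (hθ : θ ^ 2 * Fintype.card V = 1)
    (hXY : ∀ b c, X b c - Y b c = -θ * (X b i * Y j c + X b j * Y i c)) :
    ‖normTrace X - normTrace Y‖ ≤ 2 * a ^ 2 * |θ| ^ 3 := by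
  have hN : (Fintype.card V : ℝ)⁻¹ = θ ^ 2 := (eq_inv_of_mul_eq_one_left hθ).symm
  have hcs (k l : V) : ∑ b, ‖X b k * Y l b‖ ≤ a ^ 2 := by
    calc ∑ b, ‖X b k * Y l b‖ ≤ ∑ b, (‖X k b‖ ^ 2 + ‖Y l b‖ ^ 2) / 2 := by
          refine Finset.sum_le_sum fun b _ => ?_
          rw [norm_mul, hXs b k]
          nlinarith [sq_nonneg (‖X k b‖ - ‖Y l b‖)]
      _ ≤ a ^ 2 := by
          rw [← Finset.sum_div, Finset.sum_add_distrib]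
          linarith [hX k, hY l]
  have h1 : X.trace - Y.trace = -θ * (∑ b, X b i * Y j b + ∑ b, X b j * Y i b) := by
    rw [Matrix.trace, Matrix.trace, ← Finset.sum_sub_distrib, ← Finset.sum_add_distrib,
      Finset.mul_sum]
    exact Finset.sum_congr rfl fun b _ => hXY b b
  have h2 : ‖X.trace - Y.trace‖ ≤ |θ| * (a ^ 2 + a ^ 2) := by
    rw [h1, norm_mul, norm_neg, Complex.norm_real, Real.norm_eq_abs]
    gcongr
    exact (norm_add_le _ _).trans (add_le_add ((norm_sum_le _ _).trans (hcs i j))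
      ((norm_sum_le _ _).trans (hcs j i)))
  rw [normTrace, normTrace, ← sub_div, norm_div, Complex.norm_natCast, div_eq_mul_inv, hN]
  calc _ ≤ |θ| * (a ^ 2 + a ^ 2) * θ ^ 2 := by gcongr
    _ = _ := by rw [← sq_abs θ]; ring

theorem norm_semicircleDefect_sub_le {X Y : Matrix V V ℂ} {i j : V} {θ a η σ : ℝ} (ha : 0 ≤ a)
    (hη : 0 ≤ η) (hσ : 0 ≤ σ)
    (hXs : ∀ a b, X a b = X b a) (hX : ∀ i, ∑ j, ‖X i j‖ ^ 2 ≤ a ^ 2)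
    (hY : ∀ i, ∑ j, ‖Y i j‖ ^ 2 ≤ a ^ 2) (hθ : θ ^ 2 * Fintype.card V = 1)
    (hXY : ∀ b c, X b c - Y b c = -θ * (X b i * Y j c + X b j * Y i c)) :
    ‖semicircleDefect η σ X - semicircleDefect η σ Y‖
      ≤ 2 * a ^ 2 * |θ| ^ 3 * (η + σ * (2 * a)) := by
  have h1 : semicircleDefect η σ X - semicircleDefect η σ Y = (normTrace X - normTrace Y) *
      (Complex.I * η + σ * (normTrace X + normTrace Y)) := by
    rw [semicircleDefect, semicircleDefect]; ring
  rw [h1, norm_mul]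
  gcongr
  · exact norm_normTrace_sub_le hXs hX hY hθ hXY
  · refine (norm_add_le _ _).trans ?_
    simp only [norm_mul, Complex.norm_I, Complex.norm_real, Real.norm_eq_abs,
      abs_of_nonneg hη, abs_of_nonneg hσ, one_mul]
    gcongr
    exact (norm_add_le _ _).trans
      (by linarith [norm_normTrace_le ha hX, norm_normTrace_le ha hY])

/-- First order expansion of `R ↦ Rᵢⱼ · conj (defect R)` under a change of a single entry. -/
theorem norm_resolvent_expansion_le {X Y : Matrix V V ℂ} {i j : V} {θ a η σ : ℝ} (ha : 0 ≤ a)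
    (hη : 0 ≤ η) (hσ : 0 ≤ σ)
    (hXs : ∀ a b, X a b = X b a) (hX : ∀ i, ∑ j, ‖X i j‖ ^ 2 ≤ a ^ 2)
    (hY : ∀ i, ∑ j, ‖Y i j‖ ^ 2 ≤ a ^ 2) (hθ : θ ^ 2 * Fintype.card V = 1) (hθ1 : |θ| ≤ 1)
    (hXY : ∀ b c, X b c - Y b c = -θ * (X b i * Y j c + X b j * Y i c)) :
    ‖θ * (X i j * star (semicircleDefect η σ X) - Y i j * star (semicircleDefect η σ Y))
        + (θ : ℂ) ^ 2 * (X i i * X j j) * star (semicircleDefect η σ X)‖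
      ≤ (4 * a ^ 3 * (1 + η * a + σ * a ^ 2) + 2 * a ^ 3 * (η + σ * (2 * a))) * |θ| ^ 3
        + |θ| ^ 2 * (1 + η * a + σ * a ^ 2) * ‖X i j‖ ^ 2 := by
  set WX := semicircleDefect η σ X
  set WY := semicircleDefect η σ Y
  have hXe := norm_apply_le_of_row ha hX
  have hYe := norm_apply_le_of_row ha hY
  have hW : ‖WX‖ ≤ 1 + η * a + σ * a ^ 2 := norm_semicircleDefect_le hη hσ ha hX
  have hdW := norm_semicircleDefect_sub_le ha hη hσ hXs hX hY hθ hXY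
  have hd (b c : V) : ‖X b c - Y b c‖ ≤ |θ| * (2 * a ^ 2) := by
    rw [hXY, norm_mul, norm_neg, Complex.norm_real, Real.norm_eq_abs]
    gcongr
    refine (norm_add_le _ _).trans ?_
    rw [norm_mul, norm_mul]
    have h1 := mul_le_mul (hXe b i) (hYe j c) (norm_nonneg _) ha
    have h2 := mul_le_mul (hXe b j) (hYe i c) (norm_nonneg _) ha
    linarith
  have e : θ * (X i j * star WX - Y i j * star WY) + (θ : ℂ) ^ 2 * (X i i * X j j) * star WX
      = (θ : ℂ) ^ 2 * (X i i * (X j j - Y j j) + X i j * (X i j - Y i j)) * star WX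
        + θ * Y i j * star (WX - WY) - (θ : ℂ) ^ 2 * star WX * X i j ^ 2 := by
    have := hXY i j
    rw [star_sub]
    linear_combination (θ * star WX) * this
  rw [e]
  refine (norm_sub_le _ _).trans (add_le_add ((norm_add_le _ _).trans ?_) ?_)
  · rw [norm_mul, norm_mul, norm_mul, norm_mul, norm_star, norm_star, norm_pow, Complex.norm_real,
      Real.norm_eq_abs]
    have h1 : ‖X i i * (X j j - Y j j) + X i j * (X i j - Y i j)‖
        ≤ a * (|θ| * (2 * a ^ 2)) + a * (|θ| * (2 * a ^ 2)) := by
      refine (norm_add_le _ _).trans ?_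
      rw [norm_mul, norm_mul]
      gcongr
      exacts [hXe i i, hd j j, hXe i j, hd i j]
    calc _ ≤ |θ| ^ 2 * (a * (|θ| * (2 * a ^ 2)) + a * (|θ| * (2 * a ^ 2)))
          * (1 + η * a + σ * a ^ 2)
          + 1 * a * (2 * a ^ 2 * |θ| ^ 3 * (η + σ * (2 * a))) := by
            gcongr
            exact hYe i j
      _ = _ := by ring
  · simp only [norm_mul, norm_pow, norm_star, Complex.norm_real, Real.norm_eq_abs]
    gcongr

/-- The centered and normalized adjacency matrix of a graph. -/
noncomputable def normalizedAdj (p : ℝ) (G : SimpleGraph V) : Matrix V V ℝ :=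
  Matrix.of fun i j => if i = j then 0 else
    (Real.sqrt (Fintype.card V))⁻¹ * (adjIndicator G i j - p)

theorem normalizedAdj_isHermitian (p : ℝ) (G : SimpleGraph V) :
    (normalizedAdj p G).IsHermitian := by
  refine Matrix.IsHermitian.ext fun i j => ?_
  simp [normalizedAdj, eq_comm, adjIndicator_comm G i j]

open SimpleGraph in
theorem normalizedAdj_sup_edge_sub (p : ℝ) (G : SimpleGraph V) {i j : V} (hij : i ≠ j) :
    normalizedAdj p (G ⊔ edge i j) - normalizedAdj p (G \ edge i j)
      = (Real.sqrt (Fintype.card V))⁻¹ • (Matrix.single i j 1 + Matrix.single j i 1) := by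
  ext a b
  simp only [normalizedAdj, Matrix.sub_apply, Matrix.of_apply, Matrix.smul_apply, Matrix.add_apply,
    smul_eq_mul]
  by_cases hab : a = b
  · have h1 : ¬ (i = a ∧ j = a) := by rintro ⟨rfl, h⟩; exact hij h.symm
    have h2 : ¬ (j = a ∧ i = a) := by tauto
    subst hab
    simp [h1, h2]
  · by_cases h : s(a, b) = s(i, j)
    · rcases Sym2.eq_iff.mp h with ⟨rfl, rfl⟩ | ⟨rfl, rfl⟩
      · rw [adjIndicator_sup_edge hij, adjIndicator_sdiff_edge hij]
        simp [hab, Ne.symm hab]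
        ring
      · rw [adjIndicator_comm, adjIndicator_sup_edge hij, adjIndicator_comm,
          adjIndicator_sdiff_edge hij]
        simp [hab, Ne.symm hab]
        ring
    · rw [adjIndicator_sup_edge_of_ne h, adjIndicator_sdiff_edge_of_ne h]
      have h1 : ¬ (i = a ∧ j = b) := by rintro ⟨rfl, rfl⟩; exact h rfl
      have h2 : ¬ (j = a ∧ i = b) := by rintro ⟨rfl, rfl⟩; exact h Sym2.eq_swap
      simp [h1, h2]

theorem imResolvent_sub_apply {A B : Matrix V V ℝ} (hA : A.IsHermitian) (hB : B.IsHermitian)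
    {η : ℝ} (hη : 0 < η) {i j : V} {θ : ℝ}
    (h : A - B = θ • (Matrix.single i j 1 + Matrix.single j i 1)) (b c : V) :
    imResolvent A η b c - imResolvent B η b c = -θ *
      (imResolvent A η b i * imResolvent B η j c + imResolvent A η b j * imResolvent B η i c) := by
  have h1 := congrFun (congrFun (imResolvent_sub hA hB hη) b) c
  have h2 : (A - B).map (fun x : ℝ => (x : ℂ))
      = (θ : ℂ) • (Matrix.single i j (1 : ℂ) + Matrix.single j i 1) := by
    rw [h]
    ext b c
    simp only [Matrix.map_apply, Matrix.smul_apply, Matrix.add_apply, Matrix.single_apply,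
      smul_eq_mul]
    split_ifs <;> simp
  rw [Matrix.sub_apply] at h1
  rw [h1, h2, Matrix.neg_apply, Matrix.mul_smul, Matrix.smul_mul, Matrix.smul_apply, Matrix.mul_add,
    Matrix.add_mul, Matrix.add_apply]
  simp [Matrix.mul_apply, Matrix.single_apply, Finset.sum_ite_eq, ite_and]

end Resolvent

section SelfConsistent

variable {V : Type*} [Fintype V] [DecidableEq V]

/-- The resolvent of the normalized adjacency matrix at `iη`. -/
noncomputable def graphResolvent (p η : ℝ) (G : SimpleGraph V) : Matrix V V ℂ :=
  imResolvent (normalizedAdj p G) η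

theorem one_add_mul_normTrace_graphResolvent [Nonempty V] (p : ℝ) {η : ℝ} (hη : 0 < η)
    (G : SimpleGraph V) :
    1 + Complex.I * η * normTrace (graphResolvent p η G) = (((Fintype.card V : ℝ)⁻¹ : ℝ) : ℂ) *
      ∑ i, ∑ j, (normalizedAdj p G i j : ℂ) * graphResolvent p η G i j := by
  obtain ⟨h1, h2, -⟩ := imResolvent_spec (normalizedAdj_isHermitian p G) hη
  have hN : (Fintype.card V : ℂ) ≠ 0 := by exact_mod_cast Fintype.card_ne_zero
  have h3 := congrArg Matrix.trace h1
  rw [Matrix.sub_mul, Matrix.trace_sub, Matrix.smul_mul, Matrix.one_mul, Matrix.trace_smul,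
    Matrix.trace_one, smul_eq_mul] at h3
  have h4 : ((normalizedAdj p G).map (fun x : ℝ => (x : ℂ)) *
      imResolvent (normalizedAdj p G) η).trace =
      ∑ i, ∑ j, (normalizedAdj p G i j : ℂ) * graphResolvent p η G i j := by
    simp only [Matrix.trace, Matrix.diag_apply, Matrix.mul_apply, Matrix.map_apply]
    refine Finset.sum_congr rfl fun i _ => Finset.sum_congr rfl fun j _ => ?_
    rw [h2 j i]; rfl
  rw [← h4, normTrace, sub_eq_iff_eq_add.mp h3, graphResolvent]
  push_cast
  field_simp

open SimpleGraph in
/-- The discrete derivative of `Rᵢⱼ · conj (defect R)` in the edge `{i, j}`. -/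
noncomputable def resolventDifference (p η σ : ℝ) (G : SimpleGraph V) (i j : V) : ℂ :=
  if i = j then 0 else (((Real.sqrt (Fintype.card V))⁻¹ : ℝ) : ℂ) *
    (graphResolvent p η (G ⊔ edge i j) i j *
        star (semicircleDefect η σ (graphResolvent p η (G ⊔ edge i j))) -
      graphResolvent p η (G \ edge i j) i j *
        star (semicircleDefect η σ (graphResolvent p η (G \ edge i j))))

open SimpleGraph in
theorem norm_resolventDifference_add_le [Nonempty V] (p : ℝ) {η σ t : ℝ} (hη : 0 < η)
    (hσ : 0 ≤ σ) (ht : t = (Real.sqrt (Fintype.card V))⁻¹) (G : SimpleGraph V) (i j : V) :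
    ‖resolventDifference p η σ G i j + (t : ℂ) ^ 2 *
        (graphResolvent p η G i i * graphResolvent p η G j j) *
        star (semicircleDefect η σ (graphResolvent p η G))‖
      ≤ (4 * (1 / η) ^ 3 * (1 + η * (1 / η) + σ * (1 / η) ^ 2) +
          2 * (1 / η) ^ 3 * (η + σ * (2 * (1 / η)))) * t ^ 3
        + t ^ 2 * (1 + η * (1 / η) + σ * (1 / η) ^ 2) * ‖graphResolvent p η G i j‖ ^ 2 := by
  have ha : 0 ≤ 1 / η := by positivity
  have hN : (1 : ℝ) ≤ Fintype.card V := by exact_mod_cast Fintype.card_pos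
  have ht0 : 0 ≤ t := by rw [ht]; positivity
  have ht1 : |t| ≤ 1 := by
    rw [abs_of_nonneg ht0, ht]
    exact inv_le_one_of_one_le₀ (Real.one_le_sqrt.mpr hN)
  have htN : t ^ 2 * Fintype.card V = 1 := by
    rw [ht, inv_pow, Real.sq_sqrt (by positivity), inv_mul_cancel₀ (by positivity)]
  have spec (G : SimpleGraph V) := imResolvent_spec (normalizedAdj_isHermitian p G) hη
  by_cases hij : i = j
  · subst hij
    rw [resolventDifference, if_pos rfl, zero_add]
    simp only [norm_mul, norm_pow, norm_star, Complex.norm_real, Real.norm_eq_abs,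
      abs_of_nonneg ht0]
    have h1 : ‖semicircleDefect η σ (graphResolvent p η G)‖ ≤ _ :=
      norm_semicircleDefect_le hη.le hσ ha (spec G).2.2.1
    calc _ ≤ t ^ 2 * (‖graphResolvent p η G i i‖ * ‖graphResolvent p η G i i‖) *
          (1 + η * (1 / η) + σ * (1 / η) ^ 2) := by gcongr
      _ = t ^ 2 * (1 + η * (1 / η) + σ * (1 / η) ^ 2) * ‖graphResolvent p η G i i‖ ^ 2 := by ring
      _ ≤ _ := le_add_of_nonneg_left (by positivity)
  · rw [resolventDifference, if_neg hij, ← ht]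
    have hsub := normalizedAdj_sup_edge_sub p G hij
    rw [← ht] at hsub
    by_cases hadj : G.Adj i j
    · have hG : G ⊔ edge i j = G := sup_eq_left.mpr ((edge_le_iff _).mpr (Or.inr hadj))
      rw [hG] at hsub ⊢
      have := norm_resolvent_expansion_le (σ := σ) ha hη.le hσ (spec G).2.1 (spec G).2.2.1
        (spec (G \ edge i j)).2.2.1 htN ht1
        (imResolvent_sub_apply (normalizedAdj_isHermitian p G) (normalizedAdj_isHermitian p _)
          hη hsub)
      rwa [abs_of_nonneg ht0] at this
    · have hG : G \ edge i j = G := sdiff_eq_left.mpr (by rwa [disjoint_edge])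
      rw [hG] at hsub ⊢
      have hsub' : normalizedAdj p G - normalizedAdj p (G ⊔ edge i j)
          = (-t) • (Matrix.single i j 1 + Matrix.single j i 1) := by
        rw [neg_smul, ← hsub, neg_sub]
      have := norm_resolvent_expansion_le (σ := σ) (θ := -t) ha hη.le hσ (spec G).2.1
        (spec G).2.2.1 (spec (G ⊔ edge i j)).2.2.1 (by rwa [neg_sq]) (by rwa [abs_neg])
        (imResolvent_sub_apply (normalizedAdj_isHermitian p G) (normalizedAdj_isHermitian p _)
          hη hsub')
      rw [abs_neg, abs_of_nonneg ht0] at this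
      refine le_of_eq_of_le (congrArg _ ?_) this
      simp only [graphResolvent]
      push_cast
      ring

theorem sum_graphWeight_norm_sq_semicircleDefect_le [Nonempty V] (p : unitInterval) {η σ t : ℝ}
    (hη : 0 < η) (hσ : σ = p * (1 - p)) (ht : t = (Real.sqrt (Fintype.card V))⁻¹) :
    ∑ G : SimpleGraph V,
        graphWeight p G * ‖semicircleDefect η σ (graphResolvent (p : ℝ) η G)‖ ^ 2
      ≤ (σ * ((4 * (1 / η) ^ 3 * (1 + η * (1 / η) + σ * (1 / η) ^ 2) +
          2 * (1 / η) ^ 3 * (η + σ * (2 * (1 / η)))) +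
          (1 + η * (1 / η) + σ * (1 / η) ^ 2) * (1 / η) ^ 2)) * t := by
  have hσ0 : 0 ≤ σ := by
    rw [hσ]; exact mul_nonneg p.2.1 (sub_nonneg.mpr p.2.2)
  set ω := 1 + η * (1 / η) + σ * (1 / η) ^ 2 with hw
  set C := 4 * (1 / η) ^ 3 * ω + 2 * (1 / η) ^ 3 * (η + σ * (2 * (1 / η))) with hC
  have hw0 : 0 ≤ ω := by positivity
  have hC0 : 0 ≤ C := by positivity
  have hN : (1 : ℝ) ≤ Fintype.card V := by exact_mod_cast Fintype.card_pos
  have ht0 : 0 ≤ t := by rw [ht]; positivity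
  have ht1 : t ≤ 1 := by
    rw [ht]
    exact inv_le_one_of_one_le₀ (Real.one_le_sqrt.mpr hN)
  have htN : t ^ 2 * Fintype.card V = 1 := by
    rw [ht, inv_pow, Real.sq_sqrt (by positivity), inv_mul_cancel₀ (by positivity)]
  have hNinv : (Fintype.card V : ℝ)⁻¹ = t ^ 2 := (eq_inv_of_mul_eq_one_left htN).symm
  set R : SimpleGraph V → Matrix V V ℂ := graphResolvent (p : ℝ) η with hR
  set W : SimpleGraph V → ℂ := fun G => star (semicircleDefect η σ (R G)) with hW
  have ibp (i j : V) :
      ∑ G, (graphWeight p G : ℂ) * ((normalizedAdj (p : ℝ) G i j : ℂ) * (R G i j * W G)) =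
      ∑ G, (graphWeight p G : ℂ) * (σ * resolventDifference (p : ℝ) η σ G i j) := by
    by_cases hij : i = j
    · simp [normalizedAdj, resolventDifference, hij]
    · have h := sum_graphWeight_mul_indicator_sub p hij (fun G => (t : ℂ) * (R G i j * W G))
      rw [← hσ] at h
      calc _ = _ := Finset.sum_congr rfl fun G _ => ?_
        _ = _ := h
        _ = _ := Finset.sum_congr rfl fun G _ => ?_
      · rw [normalizedAdj, Matrix.of_apply, if_neg hij, ← ht]
        push_cast; ring
      · rw [resolventDifference, if_neg hij, ← ht]
        simp only [hR, hW]; ring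
  have hmain : ((∑ G : SimpleGraph V, graphWeight p G * ‖semicircleDefect η σ (R G)‖ ^ 2 : ℝ) : ℂ)
      = ∑ G, (graphWeight p G : ℂ) * (σ * t ^ 2 * ∑ i, ∑ j,
        (resolventDifference (p : ℝ) η σ G i j + (t : ℂ) ^ 2 * (R G i i * R G j j) * W G)) := by
    have h1 (G : SimpleGraph V) : ((‖semicircleDefect η σ (R G)‖ ^ 2 : ℝ) : ℂ) =
        (t : ℂ) ^ 2 * ∑ i, ∑ j, (normalizedAdj (p : ℝ) G i j : ℂ) * (R G i j * W G) +
        σ * t ^ 2 * ∑ i, ∑ j, (t : ℂ) ^ 2 * (R G i i * R G j j) * W G := by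
      have h2 : ((‖semicircleDefect η σ (R G)‖ ^ 2 : ℝ) : ℂ) =
          semicircleDefect η σ (R G) * W G := by
        rw [hW]; simp [Complex.mul_conj']
      have h3 : ∑ i, ∑ j, (t : ℂ) ^ 2 * (R G i i * R G j j) * W G
          = (t : ℂ) ^ 2 * (R G).trace ^ 2 * W G := by
        rw [Matrix.trace, sq (∑ i, _), Finset.sum_mul_sum, Finset.mul_sum, Finset.sum_mul]
        simp_rw [Finset.mul_sum, Finset.sum_mul]
        rfl
      have h4 : ∑ i, ∑ j, (normalizedAdj (p : ℝ) G i j : ℂ) * (R G i j * W G)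
          = (∑ i, ∑ j, (normalizedAdj (p : ℝ) G i j : ℂ) * R G i j) * W G := by
        simp_rw [Finset.sum_mul, mul_assoc]
      have h5 : normTrace (R G) = (t : ℂ) ^ 2 * (R G).trace := by
        rw [normTrace, div_eq_inv_mul]
        congr 1
        simpa using congrArg (fun x : ℝ => (x : ℂ)) hNinv
      rw [h2, h3, h4]
      nth_rewrite 1 [semicircleDefect]
      rw [one_add_mul_normTrace_graphResolvent (p : ℝ) hη G, hNinv, h5]
      push_cast
      ring
    push_cast at h1 ⊢
    simp_rw [h1, Finset.sum_add_distrib, mul_add, Finset.sum_add_distrib]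
    congr 1
    calc _ = (t : ℂ) ^ 2 * ∑ i, ∑ j, ∑ G, (graphWeight p G : ℂ) *
          ((normalizedAdj (p : ℝ) G i j : ℂ) * (R G i j * W G)) := by
          simp_rw [Finset.mul_sum]
          rw [Finset.sum_comm]
          refine Finset.sum_congr rfl fun i _ => ?_
          rw [Finset.sum_comm]
          refine Finset.sum_congr rfl fun j _ => Finset.sum_congr rfl fun G _ => ?_
          ring
      _ = _ := by
          simp_rw [ibp, Finset.mul_sum]
          symm
          rw [Finset.sum_comm]
          refine Finset.sum_congr rfl fun i _ => ?_
          rw [Finset.sum_comm]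
          refine Finset.sum_congr rfl fun j _ => Finset.sum_congr rfl fun G _ => ?_
          ring
  have hbound (G : SimpleGraph V) : ‖(σ : ℂ) * t ^ 2 * ∑ i, ∑ j,
      (resolventDifference (p : ℝ) η σ G i j + (t : ℂ) ^ 2 * (R G i i * R G j j) * W G)‖
      ≤ σ * (C + ω * (1 / η) ^ 2) * t := by
    have hrow := (imResolvent_spec (normalizedAdj_isHermitian (p : ℝ) G) hη).2.2.1
    have hs : ‖∑ i, ∑ j, (resolventDifference (p : ℝ) η σ G i j +
        (t : ℂ) ^ 2 * (R G i i * R G j j) * W G)‖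
        ≤ ∑ _i : V, (Fintype.card V * (C * t ^ 3) + t ^ 2 * ω * (1 / η) ^ 2) := by
      refine (norm_sum_le _ _).trans (Finset.sum_le_sum fun i _ => (norm_sum_le _ _).trans ?_)
      calc _ ≤ ∑ j, (C * t ^ 3 + t ^ 2 * ω * ‖R G i j‖ ^ 2) :=
            Finset.sum_le_sum fun j _ => norm_resolventDifference_add_le (p : ℝ) hη hσ0 ht G i j
        _ = Fintype.card V * (C * t ^ 3) + t ^ 2 * ω * ∑ j, ‖R G i j‖ ^ 2 := by
            rw [Finset.sum_add_distrib, Finset.mul_sum, Finset.sum_const, Finset.card_univ,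
              nsmul_eq_mul]
        _ ≤ _ := by
            gcongr
            exact hrow i
    rw [norm_mul, norm_mul, norm_pow, Complex.norm_real, Complex.norm_real, Real.norm_eq_abs,
      Real.norm_eq_abs, abs_of_nonneg hσ0, abs_of_nonneg ht0]
    calc _ ≤ σ * t ^ 2 *
          ∑ _i : V, (Fintype.card V * (C * t ^ 3) + t ^ 2 * ω * (1 / η) ^ 2) := by gcongr
      _ = σ * (C * t * (t ^ 2 * Fintype.card V) ^ 2 +
            ω * (1 / η) ^ 2 * t ^ 2 * (t ^ 2 * Fintype.card V)) := by
          rw [Finset.sum_const, Finset.card_univ, nsmul_eq_mul]; ring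
      _ ≤ σ * (C * t + ω * (1 / η) ^ 2 * t) := by
          rw [htN]
          have : t ^ 2 ≤ t := by nlinarith
          have h0 : 0 ≤ ω * (1 / η) ^ 2 := by positivity
          refine mul_le_mul_of_nonneg_left ?_ hσ0
          nlinarith [mul_le_mul_of_nonneg_left this h0]
      _ = _ := by ring
  have hnonneg : 0 ≤ ∑ G : SimpleGraph V, graphWeight p G * ‖semicircleDefect η σ (R G)‖ ^ 2 :=
    Finset.sum_nonneg fun G _ => mul_nonneg (graphWeight_nonneg p G) (by positivity)
  calc _ = ‖((∑ G : SimpleGraph V,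
          graphWeight p G * ‖semicircleDefect η σ (R G)‖ ^ 2 : ℝ) : ℂ)‖ := by
        rw [Complex.norm_real, Real.norm_eq_abs, abs_of_nonneg hnonneg]
    _ ≤ ∑ G : SimpleGraph V, graphWeight p G * (σ * (C + ω * (1 / η) ^ 2) * t) := by
        rw [hmain]
        refine (norm_sum_le _ _).trans (Finset.sum_le_sum fun G _ => ?_)
        rw [norm_mul, Complex.norm_real, Real.norm_eq_abs, abs_of_nonneg (graphWeight_nonneg p G)]
        exact mul_le_mul_of_nonneg_left (hbound G) (graphWeight_nonneg p G)
    _ = _ := by rw [← Finset.sum_mul, sum_graphWeight, one_mul]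

end SelfConsistent

section SemicircleTransform

/-- The imaginary part of the Stieltjes transform at `iη` of the semicircle law of variance
`σ`. -/
noncomputable def semicircleStieltjes (σ η : ℝ) : ℝ :=
  (Real.sqrt (η ^ 2 + 4 * σ) - η) / (2 * σ)

theorem semicircleStieltjes_nonneg {σ η : ℝ} (hσ : 0 < σ) : 0 ≤ semicircleStieltjes σ η := by
  refine div_nonneg (sub_nonneg.mpr ?_) (by positivity)
  exact Real.le_sqrt_of_sq_le (by linarith)

theorem semicircleStieltjes_eq {σ : ℝ} (hσ : 0 < σ) (η : ℝ) :
    η * semicircleStieltjes σ η + σ * semicircleStieltjes σ η ^ 2 = 1 := by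
  have h : Real.sqrt (η ^ 2 + 4 * σ) ^ 2 = η ^ 2 + 4 * σ := Real.sq_sqrt (by positivity)
  rw [semicircleStieltjes]
  field_simp
  linear_combination h

theorem semicircleStieltjes_le {σ η : ℝ} (hσ : 0 < σ) (hη : 0 < η) :
    semicircleStieltjes σ η ≤ 1 / η := by
  rw [le_div_iff₀ hη]
  nlinarith [semicircleStieltjes_eq hσ η, sq_nonneg (semicircleStieltjes σ η)]

theorem hasDerivAt_semicircleStieltjes {σ : ℝ} (hσ : 0 < σ) (η : ℝ) :
    HasDerivAt (semicircleStieltjes σ)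
      (-semicircleStieltjes σ η / Real.sqrt (η ^ 2 + 4 * σ)) η := by
  have h0 : η ^ 2 + 4 * σ ≠ 0 := by positivity
  have hr : Real.sqrt (η ^ 2 + 4 * σ) ≠ 0 := (Real.sqrt_pos.mpr (by positivity)).ne'
  have h1 : HasDerivAt (fun x : ℝ => x ^ 2 + 4 * σ) (2 * η) η := by
    simpa using (hasDerivAt_pow 2 η).add_const (4 * σ)
  have h2 := ((h1.sqrt h0).sub (hasDerivAt_id η)).div_const (2 * σ)
  refine h2.congr_deriv ?_
  rw [semicircleStieltjes]
  field_simp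
  ring

theorem hasDerivAt_primitive_sq_semicircleStieltjes {σ : ℝ} (hσ : 0 < σ) (η : ℝ) :
    HasDerivAt (fun x => -(σ * semicircleStieltjes σ x + σ ^ 2 / 3 * semicircleStieltjes σ x ^ 3))
      (σ * semicircleStieltjes σ η ^ 2) η := by
  have h := hasDerivAt_semicircleStieltjes hσ η
  have h1 := ((h.const_mul σ).add ((h.pow 3).const_mul (σ ^ 2 / 3))).neg
  refine h1.congr_deriv ?_
  have hr : 0 < Real.sqrt (η ^ 2 + 4 * σ) := Real.sqrt_pos.mpr (by positivity)
  have hu : semicircleStieltjes σ η * (2 * σ) = Real.sqrt (η ^ 2 + 4 * σ) - η := by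
    rw [semicircleStieltjes, div_mul_cancel₀ _ (by positivity)]
  have he := semicircleStieltjes_eq hσ η
  set u := semicircleStieltjes σ η
  set r := Real.sqrt (η ^ 2 + 4 * σ)
  simp only [Nat.cast_ofNat, Nat.add_one_sub_one]
  field_simp
  have : r = u * (2 * σ) + η := by linarith
  rw [this]
  linear_combination (-u) * he

theorem integral_sq_semicircleStieltjes {σ : ℝ} (hσ : 0 < σ) :
    IntegrableOn (fun η => σ * semicircleStieltjes σ η ^ 2) (Set.Ioi 0) ∧
      ∫ η in Set.Ioi (0 : ℝ), σ * semicircleStieltjes σ η ^ 2 = 4 / 3 * Real.sqrt σ := by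
  have hlim : Tendsto (semicircleStieltjes σ) atTop (𝓝 0) := by
    refine squeeze_zero' (Eventually.of_forall fun η => semicircleStieltjes_nonneg hσ) ?_
      tendsto_inv_atTop_zero
    filter_upwards [eventually_gt_atTop 0] with η hη
    rw [← one_div]
    exact semicircleStieltjes_le hσ hη
  have hlim' : Tendsto (fun x => -(σ * semicircleStieltjes σ x +
      σ ^ 2 / 3 * semicircleStieltjes σ x ^ 3)) atTop (𝓝 0) := by
    simpa using ((hlim.const_mul σ).add ((hlim.pow 3).const_mul (σ ^ 2 / 3))).neg
  have hd := fun x (_ : x ∈ Set.Ioi (0 : ℝ)) => hasDerivAt_primitive_sq_semicircleStieltjes hσ x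
  have hc : ContinuousWithinAt (fun x => -(σ * semicircleStieltjes σ x +
      σ ^ 2 / 3 * semicircleStieltjes σ x ^ 3)) (Set.Ici 0) 0 :=
    (hasDerivAt_primitive_sq_semicircleStieltjes hσ 0).continuousAt.continuousWithinAt
  have hpos : ∀ x ∈ Set.Ioi (0 : ℝ), 0 ≤ σ * semicircleStieltjes σ x ^ 2 :=
    fun x _ => by positivity
  refine ⟨integrableOn_Ioi_deriv_of_nonneg hc hd hpos hlim', ?_⟩
  rw [integral_Ioi_of_hasDerivAt_of_nonneg hc hd hpos hlim']
  have hs : Real.sqrt σ ^ 2 = σ := Real.sq_sqrt hσ.le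
  have hs0 : 0 < Real.sqrt σ := Real.sqrt_pos.mpr hσ
  have h0 : semicircleStieltjes σ 0 = 1 / Real.sqrt σ := by
    have h4 : Real.sqrt ((0 : ℝ) ^ 2 + 4 * σ) = 2 * Real.sqrt σ := by
      rw [show (0 : ℝ) ^ 2 + 4 * σ = 2 ^ 2 * σ by ring, Real.sqrt_mul (by norm_num),
        Real.sqrt_sq (by norm_num)]
    rw [semicircleStieltjes, h4]
    nth_rewrite 2 [← hs]
    field_simp
    ring
  rw [h0]
  nth_rewrite 1 [← hs]
  nth_rewrite 3 [← hs]
  field_simp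
  ring

theorem integral_sq_div_sq_add_sq (l : ℝ) :
    IntegrableOn (fun t : ℝ => l ^ 2 / (l ^ 2 + t ^ 2)) (Set.Ioi 0) ∧
      ∫ t in Set.Ioi (0 : ℝ), l ^ 2 / (l ^ 2 + t ^ 2) = Real.pi / 2 * |l| := by
  by_cases hl : l = 0
  · simp [hl]
  have hc : 0 < |l| := abs_pos.mpr hl
  have hd (t : ℝ) : HasDerivAt (fun t => |l| * Real.arctan (t / |l|)) (l ^ 2 / (l ^ 2 + t ^ 2)) t := by
    refine ((((hasDerivAt_id t).div_const |l|).arctan).const_mul |l|).congr_deriv ?_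
    rw [← sq_abs l, id]
    field_simp
  have hlim : Tendsto (fun t => |l| * Real.arctan (t / |l|)) atTop (𝓝 (|l| * (Real.pi / 2))) := by
    refine Tendsto.const_mul _ ?_
    have h1 : Tendsto Real.arctan atTop (𝓝 (Real.pi / 2)) :=
      Real.tendsto_arctan_atTop.mono_right nhdsWithin_le_nhds
    exact h1.comp (tendsto_id.atTop_div_const hc)
  have hcont : ContinuousWithinAt (fun t => |l| * Real.arctan (t / |l|)) (Set.Ici 0) 0 :=
    (hd 0).continuousAt.continuousWithinAt
  have hpos : ∀ t ∈ Set.Ioi (0 : ℝ), 0 ≤ l ^ 2 / (l ^ 2 + t ^ 2) := fun t _ => by positivity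
  refine ⟨integrableOn_Ioi_deriv_of_nonneg hcont (fun t _ => hd t) hpos hlim, ?_⟩
  rw [integral_Ioi_of_hasDerivAt_of_nonneg hcont (fun t _ => hd t) hpos hlim]
  simp [mul_comm]

variable {V : Type*} [Fintype V] [DecidableEq V]

/-- The average of `λ² / (λ² + η²)` over the eigenvalues `λ` of a symmetric matrix. -/
noncomputable def spectralProfile {A : Matrix V V ℝ} (hA : A.IsHermitian) (η : ℝ) : ℝ :=
  (∑ k, hA.eigenvalues k ^ 2 / (hA.eigenvalues k ^ 2 + η ^ 2)) / Fintype.card V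

theorem integral_spectralProfile {A : Matrix V V ℝ} (hA : A.IsHermitian) :
    IntegrableOn (spectralProfile hA) (Set.Ioi 0) ∧
      ∫ η in Set.Ioi (0 : ℝ), spectralProfile hA η
        = Real.pi / 2 * (matrixEnergy hA / Fintype.card V) := by
  have hi (k : V) := (integral_sq_div_sq_add_sq (hA.eigenvalues k)).1
  constructor
  · exact Integrable.div_const (integrable_finsetSum _ fun k _ => hi k) _
  · simp only [spectralProfile]
    rw [integral_div, integral_finsetSum _ fun k _ => hi k]
    simp_rw [fun l => (integral_sq_div_sq_add_sq l).2]
    rw [← Finset.mul_sum, matrixEnergy, mul_div_assoc]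

theorem spectralProfile_nonneg {A : Matrix V V ℝ} (hA : A.IsHermitian) (η : ℝ) :
    0 ≤ spectralProfile hA η :=
  div_nonneg (Finset.sum_nonneg fun _ _ => by positivity) (by positivity)

theorem spectralProfile_le_one {A : Matrix V V ℝ} (hA : A.IsHermitian) (η : ℝ) :
    spectralProfile hA η ≤ 1 := by
  refine div_le_one_of_le₀ ?_ (by positivity)
  calc _ ≤ ∑ _k : V, (1 : ℝ) := Finset.sum_le_sum fun k _ =>
        div_le_one_of_le₀ (by nlinarith [sq_nonneg η]) (by positivity)
    _ = _ := by simp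

theorem spectralProfile_mul_sq_le {A : Matrix V V ℝ} (hA : A.IsHermitian) {η : ℝ} (hη : 0 < η)
    (hA2 : ∑ i, ∑ j, A i j ^ 2 ≤ Fintype.card V) : spectralProfile hA η * η ^ 2 ≤ 1 := by
  rw [spectralProfile, div_mul_eq_mul_div]
  refine div_le_one_of_le₀ ?_ (by positivity)
  rw [← hA.sum_sq_eigenvalues] at hA2
  refine le_trans ?_ hA2
  rw [Finset.sum_mul]
  refine Finset.sum_le_sum fun k _ => ?_
  rw [div_mul_eq_mul_div, div_le_iff₀ (by positivity)]
  nlinarith [sq_nonneg (hA.eigenvalues k ^ 2)]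

theorem one_sub_spectralProfile [Nonempty V] {A : Matrix V V ℝ} (hA : A.IsHermitian) {η : ℝ}
    (hη : 0 < η) : 1 - spectralProfile hA η = η * (normTrace (imResolvent A η)).im := by
  have hN : (Fintype.card V : ℝ) ≠ 0 := by exact_mod_cast Fintype.card_ne_zero
  rw [normTrace, Complex.div_natCast_im, (imResolvent_spec hA hη).2.2.2, spectralProfile]
  rw [← mul_div_assoc, sub_eq_iff_eq_add, ← add_div, eq_div_iff hN, Finset.mul_sum,
    ← Finset.sum_add_distrib, one_mul]
  rw [Finset.sum_congr rfl (g := fun _ => (1 : ℝ)), Finset.sum_const, Finset.card_univ,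
    nsmul_eq_mul, mul_one]
  intro k _
  have : hA.eigenvalues k ^ 2 + η ^ 2 ≠ 0 := by positivity
  field_simp
  ring

theorem abs_spectralProfile_sub_le [Nonempty V] {A : Matrix V V ℝ} (hA : A.IsHermitian) {η σ : ℝ}
    (hη : 0 < η) (hσ : 0 < σ) :
    |spectralProfile hA η - σ * semicircleStieltjes σ η ^ 2| ≤
      ‖semicircleDefect η σ (imResolvent A η)‖ +
        σ / η ^ 2 * ‖semicircleDefect η σ (imResolvent A η)‖ ^ 2 := by
  have h1 := one_sub_spectralProfile hA hη
  have h2 := semicircleStieltjes_eq hσ η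
  have hu0 := semicircleStieltjes_nonneg (η := η) hσ
  set Φ := semicircleDefect η σ (imResolvent A η) with hΦ
  set g := normTrace (imResolvent A η) with hg
  set u := semicircleStieltjes σ η
  have him0 : 0 ≤ g.im := by
    have := spectralProfile_le_one hA η
    by_contra hcon
    push Not at hcon
    nlinarith
  have hre : Φ.re = 1 - η * g.im + σ * (g.re ^ 2 - g.im ^ 2) := by
    simp [hΦ, semicircleDefect, ← hg, sq, Complex.mul_re, Complex.mul_im]
    ring
  have him : Φ.im = g.re * (η + 2 * σ * g.im) := by
    simp [hΦ, semicircleDefect, ← hg, sq, Complex.mul_re, Complex.mul_im]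
    ring
  have hgre : η * |g.re| ≤ ‖Φ‖ := by
    refine le_trans ?_ (Complex.abs_im_le_norm Φ)
    rw [him, abs_mul, mul_comm]
    refine mul_le_mul_of_nonneg_left ?_ (abs_nonneg _)
    refine le_trans ?_ (le_abs_self _)
    have : 0 ≤ 2 * σ * g.im := by positivity
    linarith
  have hgre2 : g.re ^ 2 ≤ ‖Φ‖ ^ 2 / η ^ 2 := by
    rw [le_div_iff₀ (by positivity), ← sq_abs g.re, ← mul_pow, mul_comm]
    gcongr
  have hfac : (g.im - u) * (η + σ * (g.im + u)) = σ * g.re ^ 2 - Φ.re := by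
    rw [hre]; linear_combination (-1 : ℝ) * h2
  have hle : |g.im - u| * (η + σ * (g.im + u)) ≤ ‖Φ‖ + σ * (‖Φ‖ ^ 2 / η ^ 2) := by
    have hp : 0 ≤ η + σ * (g.im + u) := by positivity
    rw [← abs_of_nonneg hp, ← abs_mul, hfac]
    refine (abs_sub _ _).trans ?_
    rw [add_comm]
    gcongr
    · exact Complex.abs_re_le_norm Φ
    · rw [abs_of_nonneg (by positivity)]
      gcongr
  have he : spectralProfile hA η - σ * u ^ 2 = -(η * (g.im - u)) := by
    linear_combination (-1 : ℝ) * h1 - h2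
  rw [he, abs_neg, abs_mul, abs_of_pos hη]
  calc η * |g.im - u| ≤ |g.im - u| * (η + σ * (g.im + u)) := by
        rw [mul_comm]
        refine mul_le_mul_of_nonneg_left ?_ (abs_nonneg _)
        have : 0 ≤ σ * (g.im + u) := by positivity
        linarith
    _ ≤ _ := hle
    _ = _ := by ring

theorem abs_spectralProfile_sub_le_inv [Nonempty V] {A : Matrix V V ℝ} (hA : A.IsHermitian)
    {η σ : ℝ} (hη : 0 < η) (hσ : 0 < σ) (hσ1 : σ ≤ 1)
    (hA2 : ∑ i, ∑ j, A i j ^ 2 ≤ Fintype.card V) :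
    |spectralProfile hA η - σ * semicircleStieltjes σ η ^ 2| ≤ 2 * (1 + η ^ 2)⁻¹ := by
  have hu0 := semicircleStieltjes_nonneg (η := η) hσ
  have h1 := spectralProfile_le_one hA η
  have h2 := spectralProfile_mul_sq_le hA hη hA2
  have h3 : σ * semicircleStieltjes σ η ^ 2 ≤ 1 := by
    have := semicircleStieltjes_eq hσ η
    have : 0 ≤ η * semicircleStieltjes σ η := by positivity
    linarith
  have h4 : σ * semicircleStieltjes σ η ^ 2 * η ^ 2 ≤ 1 := by
    have h := semicircleStieltjes_le hσ hη
    rw [le_div_iff₀ hη] at h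
    rw [mul_assoc, ← mul_pow]
    exact mul_le_one₀ hσ1 (by positivity) (pow_le_one₀ (by positivity) h)
  have hb {x : ℝ} (hx : x ≤ 1) (hx2 : x * η ^ 2 ≤ 1) : x ≤ 2 * (1 + η ^ 2)⁻¹ := by
    rw [← div_eq_mul_inv, le_div_iff₀ (by positivity)]
    linarith
  rw [abs_le]
  have h5 := spectralProfile_nonneg hA η
  have h6 : 0 ≤ σ * semicircleStieltjes σ η ^ 2 := by positivity
  constructor
  · linarith [hb h3 h4]
  · linarith [hb h1 h2]

end SemicircleTransform

section Convergence

open SimpleGraph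

theorem sum_sq_normalizedAdj_le {V : Type*} [Fintype V] [DecidableEq V] (p : unitInterval)
    (G : SimpleGraph V) :
    ∑ i, ∑ j, normalizedAdj (p : ℝ) G i j ^ 2 ≤ Fintype.card V := by
  have hent (i j : V) : normalizedAdj (p : ℝ) G i j ^ 2 ≤ (Fintype.card V : ℝ)⁻¹ := by
    rw [normalizedAdj, Matrix.of_apply]
    split_ifs with h
    · simp
    · rw [mul_pow, inv_pow, Real.sq_sqrt (by positivity)]
      refine mul_le_of_le_one_right (by positivity) ?_
      have h0 := p.2.1
      have h1 := p.2.2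
      by_cases hG : G.Adj i j
      · rw [adjIndicator_of_adj hG]; nlinarith
      · rw [adjIndicator_of_not_adj hG]; nlinarith
  calc _ ≤ ∑ _i : V, ∑ _j : V, (Fintype.card V : ℝ)⁻¹ :=
        Finset.sum_le_sum fun i _ => Finset.sum_le_sum fun j _ => hent i j
    _ ≤ _ := by
        simp only [Finset.sum_const, Finset.card_univ, nsmul_eq_mul]
        exact mul_le_of_le_one_right (by positivity) mul_inv_le_one

/-- The expected distance of the spectral profile from its semicircle limit. -/
noncomputable def expectedProfileError (p : unitInterval) (n : ℕ) (η : ℝ) : ℝ :=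
  ∑ G : SimpleGraph (Fin n), graphWeight p G *
    |spectralProfile (normalizedAdj_isHermitian (p : ℝ) G) η -
      (p * (1 - p)) * semicircleStieltjes (p * (1 - p)) η ^ 2|

theorem tendsto_expectedProfileError {p : unitInterval} (hp0 : 0 < (p : ℝ)) (hp1 : (p : ℝ) < 1)
    {η : ℝ} (hη : 0 < η) :
    Tendsto (fun n => expectedProfileError p n η) atTop (𝓝 0) := by
  set σ : ℝ := p * (1 - p) with hσ
  have hσ0 : 0 < σ := mul_pos hp0 (sub_pos.mpr hp1)
  obtain ⟨K, hK⟩ : ∃ K : ℝ, ∀ n : ℕ, 0 < n → ∑ G : SimpleGraph (Fin n),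
      graphWeight p G * ‖semicircleDefect η σ (graphResolvent (p : ℝ) η G)‖ ^ 2
        ≤ K * (Real.sqrt n)⁻¹ := by
    exact ⟨_, fun n hn =>
      have : Nonempty (Fin n) := ⟨⟨0, hn⟩⟩
      sum_graphWeight_norm_sq_semicircleDefect_le p hη hσ (by rw [Fintype.card_fin])⟩
  have ht : Tendsto (fun n : ℕ => (Real.sqrt n)⁻¹) atTop (𝓝 0) :=
    tendsto_inv_atTop_zero.comp (Real.tendsto_sqrt_atTop.comp tendsto_natCast_atTop_atTop)
  have hs : Tendsto (fun n : ℕ => Real.sqrt ((Real.sqrt n)⁻¹)) atTop (𝓝 0) := by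
    simpa using ht.sqrt
  have hlim : Tendsto (fun n : ℕ => (1 + K) / 2 * Real.sqrt ((Real.sqrt n)⁻¹) +
      σ / η ^ 2 * (K * (Real.sqrt n)⁻¹)) atTop (𝓝 0) := by
    simpa using (hs.const_mul ((1 + K) / 2)).add ((ht.const_mul K).const_mul (σ / η ^ 2))
  refine squeeze_zero' (Eventually.of_forall fun n => Finset.sum_nonneg fun G _ =>
    mul_nonneg (graphWeight_nonneg p G) (abs_nonneg _)) ?_ hlim
  filter_upwards [eventually_gt_atTop 0] with n hn
  have : Nonempty (Fin n) := ⟨⟨0, hn⟩⟩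
  set t : ℝ := (Real.sqrt n)⁻¹ with htdef
  have htpos : 0 < t := by
    rw [htdef]; exact inv_pos.mpr (Real.sqrt_pos.mpr (by exact_mod_cast hn))
  set s : ℝ := Real.sqrt t with hsdef
  have hspos : 0 < s := Real.sqrt_pos.mpr htpos
  have hss : s ^ 2 = t := Real.sq_sqrt htpos.le
  have hpt (G : SimpleGraph (Fin n)) :
      |spectralProfile (normalizedAdj_isHermitian (p : ℝ) G) η - σ * semicircleStieltjes σ η ^ 2| ≤
      s / 2 + (1 / (2 * s) + σ / η ^ 2) *
        ‖semicircleDefect η σ (graphResolvent (p : ℝ) η G)‖ ^ 2 := by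
    refine (abs_spectralProfile_sub_le (normalizedAdj_isHermitian (p : ℝ) G) hη hσ0).trans ?_
    change ‖semicircleDefect η σ (graphResolvent (p : ℝ) η G)‖ + σ / η ^ 2 *
      ‖semicircleDefect η σ (graphResolvent (p : ℝ) η G)‖ ^ 2 ≤ _
    set x := ‖semicircleDefect η σ (graphResolvent (p : ℝ) η G)‖
    have : x ≤ s / 2 + 1 / (2 * s) * x ^ 2 := by
      have h : s / 2 + 1 / (2 * s) * x ^ 2 - x = (s - x) ^ 2 / (2 * s) := by
        field_simp; ring
      have h' : 0 ≤ (s - x) ^ 2 / (2 * s) := by positivity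
      linarith
    linarith
  calc expectedProfileError p n η ≤ ∑ G : SimpleGraph (Fin n), graphWeight p G *
        (s / 2 + (1 / (2 * s) + σ / η ^ 2) *
          ‖semicircleDefect η σ (graphResolvent (p : ℝ) η G)‖ ^ 2) :=
        Finset.sum_le_sum fun G _ => mul_le_mul_of_nonneg_left (hpt G) (graphWeight_nonneg p G)
    _ = s / 2 + (1 / (2 * s) + σ / η ^ 2) * ∑ G : SimpleGraph (Fin n), graphWeight p G *
          ‖semicircleDefect η σ (graphResolvent (p : ℝ) η G)‖ ^ 2 := by
        simp_rw [mul_add, Finset.sum_add_distrib]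
        rw [← Finset.sum_mul, sum_graphWeight, one_mul, Finset.mul_sum]
        congr 1
        exact Finset.sum_congr rfl fun G _ => by ring
    _ ≤ s / 2 + (1 / (2 * s) + σ / η ^ 2) * (K * t) := by
        gcongr
        exact hK n hn
    _ = _ := by
        rw [← hss]; field_simp; ring

theorem integrableOn_abs_spectralProfile_sub {V : Type*} [Fintype V] [DecidableEq V]
    {A : Matrix V V ℝ} (hA : A.IsHermitian) {σ : ℝ} (hσ : 0 < σ) :
    IntegrableOn (fun η => |spectralProfile hA η - σ * semicircleStieltjes σ η ^ 2|)
      (Set.Ioi 0) :=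
  ((integral_spectralProfile hA).1.sub (integral_sq_semicircleStieltjes hσ).1).abs

theorem tendsto_integral_expectedProfileError {p : unitInterval} (hp0 : 0 < (p : ℝ))
    (hp1 : (p : ℝ) < 1) :
    Tendsto (fun n => ∫ η in Set.Ioi (0 : ℝ), expectedProfileError p n η) atTop (𝓝 0) := by
  have hσ0 : 0 < (p : ℝ) * (1 - p) := mul_pos hp0 (sub_pos.mpr hp1)
  have hσ1 : (p : ℝ) * (1 - p) ≤ 1 := by nlinarith
  have h := tendsto_integral_filter_of_dominated_convergence (μ := volume.restrict (Set.Ioi (0 : ℝ)))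
    (l := atTop) (F := fun n η => expectedProfileError p n η) (f := fun _ => (0 : ℝ))
    (fun η => 2 * (1 + η ^ 2)⁻¹) ?_ ?_ ?_ ?_
  · simpa using h
  · refine Eventually.of_forall fun n => Integrable.aestronglyMeasurable ?_
    exact integrable_finsetSum _ fun G _ =>
      (integrableOn_abs_spectralProfile_sub _ hσ0).const_mul _
  · filter_upwards [eventually_gt_atTop 0] with n hn
    have : Nonempty (Fin n) := ⟨⟨0, hn⟩⟩
    refine (ae_restrict_iff' measurableSet_Ioi).mpr (Eventually.of_forall fun η hη => ?_)
    rw [Real.norm_eq_abs, expectedProfileError, abs_of_nonneg (Finset.sum_nonneg fun G _ =>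
      mul_nonneg (graphWeight_nonneg p G) (abs_nonneg _))]
    calc _ ≤ ∑ G : SimpleGraph (Fin n), graphWeight p G * (2 * (1 + η ^ 2)⁻¹) :=
          Finset.sum_le_sum fun G _ => mul_le_mul_of_nonneg_left
            (abs_spectralProfile_sub_le_inv _ hη hσ0 hσ1 (sum_sq_normalizedAdj_le p G))
            (graphWeight_nonneg p G)
      _ = _ := by rw [← Finset.sum_mul, sum_graphWeight, one_mul]
  · exact (integrable_inv_one_add_sq.const_mul 2).integrableOn
  · exact (ae_restrict_iff' measurableSet_Ioi).mpr
      (Eventually.of_forall fun η hη => tendsto_expectedProfileError hp0 hp1 hη)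

theorem abs_matrixEnergy_div_sub_le {V : Type*} [Fintype V] [DecidableEq V] {A : Matrix V V ℝ}
    (hA : A.IsHermitian) {σ : ℝ} (hσ : 0 < σ) :
    |matrixEnergy hA / Fintype.card V - 8 / (3 * Real.pi) * Real.sqrt σ| ≤
      2 / Real.pi * ∫ η in Set.Ioi (0 : ℝ),
        |spectralProfile hA η - σ * semicircleStieltjes σ η ^ 2| := by
  have h1 := integral_spectralProfile hA
  have h2 := integral_sq_semicircleStieltjes hσ
  have h3 : matrixEnergy hA / Fintype.card V - 8 / (3 * Real.pi) * Real.sqrt σ =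
      2 / Real.pi * ∫ η in Set.Ioi (0 : ℝ),
        (spectralProfile hA η - σ * semicircleStieltjes σ η ^ 2) := by
    rw [integral_sub h1.1 h2.1, h1.2, h2.2]
    field_simp
    ring
  rw [h3, abs_mul, abs_of_nonneg (by positivity)]
  gcongr
  exact abs_integral_le_integral_abs

/-- The energy of the centered normalized adjacency matrix converges in mean. -/
theorem tendsto_expected_abs_matrixEnergy_normalizedAdj_sub {p : unitInterval}
    (hp0 : 0 < (p : ℝ)) (hp1 : (p : ℝ) < 1) :
    Tendsto (fun n : ℕ => ∑ G : SimpleGraph (Fin n), graphWeight p G *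
      |matrixEnergy (normalizedAdj_isHermitian (p : ℝ) G) / n -
        8 / (3 * Real.pi) * Real.sqrt ((p : ℝ) * (1 - p))|) atTop (𝓝 0) := by
  have hσ0 : 0 < (p : ℝ) * (1 - p) := mul_pos hp0 (sub_pos.mpr hp1)
  have h := (tendsto_integral_expectedProfileError hp0 hp1).const_mul (2 / Real.pi)
  rw [mul_zero] at h
  refine squeeze_zero (fun n => Finset.sum_nonneg fun G _ =>
    mul_nonneg (graphWeight_nonneg p G) (abs_nonneg _)) (fun n => ?_) h
  have he : ∫ η in Set.Ioi (0 : ℝ), expectedProfileError p n η =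
      ∑ G : SimpleGraph (Fin n), graphWeight p G * ∫ η in Set.Ioi (0 : ℝ),
        |spectralProfile (normalizedAdj_isHermitian (p : ℝ) G) η -
          (p * (1 - p)) * semicircleStieltjes (p * (1 - p)) η ^ 2| := by
    simp only [expectedProfileError]
    rw [integral_finsetSum _ fun G _ =>
      (integrableOn_abs_spectralProfile_sub _ hσ0).const_mul _]
    simp_rw [integral_const_mul]
  rw [he, Finset.mul_sum]
  refine Finset.sum_le_sum fun G _ => ?_
  have := mul_le_mul_of_nonneg_left
    (abs_matrixEnergy_div_sub_le (normalizedAdj_isHermitian (p : ℝ) G) hσ0)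
    (graphWeight_nonneg p G)
  rw [Fintype.card_fin] at this
  linarith

theorem tendsto_binomialRandom_real_energy_deviation {p : unitInterval}
    (hp0 : 0 < (p : ℝ)) (hp1 : (p : ℝ) < 1) {δ : ℝ} (hδ : 0 < δ) :
    Tendsto (fun n : ℕ => (binomialRandom (Fin n) p).real {G : SimpleGraph (Fin n) |
      δ < |matrixEnergy (normalizedAdj_isHermitian (p : ℝ) G) / n -
        8 / (3 * Real.pi) * Real.sqrt ((p : ℝ) * (1 - p))|}) atTop (𝓝 0) := by
  classical
  have h := (tendsto_expected_abs_matrixEnergy_normalizedAdj_sub hp0 hp1).const_mul δ⁻¹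
  rw [mul_zero] at h
  refine squeeze_zero (fun n => measureReal_nonneg) (fun n => ?_) h
  rw [binomialRandom_real_eq_sum, Finset.mul_sum]
  refine Finset.sum_le_sum fun G _ => ?_
  have hw := graphWeight_nonneg p G
  split_ifs with hG
  · rw [Set.mem_ofPred_eq] at hG
    rw [inv_mul_eq_div, le_div_iff₀ hδ]
    exact mul_le_mul_of_nonneg_left hG.le hw
  · positivity

theorem abs_matrixEnergy_rcwMatrix_sub_le {n : ℕ} (hn : 2 ≤ n) {p : unitInterval}
    {G : SimpleGraph (Fin n)} (hG : G ∈ commonNeighborGraphs (Fin n)) :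
    |matrixEnergy (rcwMatrix_isHermitian G) -
      Real.sqrt n / 2 * matrixEnergy (normalizedAdj_isHermitian (p : ℝ) G)| ≤ 2 * n := by
  have : Nontrivial (Fin n) := Fin.nontrivial_iff_two_le.mpr hn
  have hs : 0 < Real.sqrt n := Real.sqrt_pos.mpr (by exact_mod_cast (by omega : 0 < n))
  have hp0 := p.2.1
  have hp1 := p.2.2
  have h1 : rcwMatrix G = (-(Real.sqrt n / 2)) • normalizedAdj (p : ℝ) G +
      (1 - (p : ℝ) / 2) • ((Matrix.of fun _ _ => (1 : ℝ) : Matrix (Fin n) (Fin n) ℝ) - 1) := by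
    ext i j
    by_cases hij : i = j
    · simp [rcwMatrix, normalizedAdj, hij]
    · rw [rcwMatrix_apply_of_mem_commonNeighborGraphs hG hij]
      simp only [normalizedAdj, Matrix.add_apply, Matrix.smul_apply, Matrix.sub_apply,
        Matrix.of_apply, if_neg hij, Matrix.one_apply_ne hij, smul_eq_mul, Fintype.card_fin]
      field_simp
      ring
  have h2 : normalizedAdj (p : ℝ) G = (-(2 / Real.sqrt n)) • rcwMatrix G +
      (2 / Real.sqrt n * (1 - (p : ℝ) / 2)) •
        ((Matrix.of fun _ _ => (1 : ℝ) : Matrix (Fin n) (Fin n) ℝ) - 1) := by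
    rw [h1, smul_add, smul_smul, smul_smul, add_assoc, ← add_smul]
    rw [show -(2 / Real.sqrt n) * -(Real.sqrt n / 2) = 1 by field_simp, one_smul]
    rw [show -(2 / Real.sqrt n) * (1 - (p : ℝ) / 2) + 2 / Real.sqrt n * (1 - (p : ℝ) / 2) = 0 by
      ring, zero_smul, add_zero]
  have e1 := matrixEnergy_le_of_eq_add (rcwMatrix_isHermitian G)
    (normalizedAdj_isHermitian (p : ℝ) G) _ _ h1
  have e2 := matrixEnergy_le_of_eq_add (normalizedAdj_isHermitian (p : ℝ) G)
    (rcwMatrix_isHermitian G) _ _ h2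
  have hc : 0 ≤ 1 - (p : ℝ) / 2 := by linarith
  rw [abs_neg, abs_of_pos (by positivity), abs_of_nonneg hc, Fintype.card_fin] at e1
  rw [abs_neg, abs_of_pos (by positivity), abs_of_nonneg (by positivity), Fintype.card_fin] at e2
  have e3 := mul_le_mul_of_nonneg_left e2 (by positivity : 0 ≤ Real.sqrt n / 2)
  have e4 : Real.sqrt n / 2 * (2 / Real.sqrt n * matrixEnergy (rcwMatrix_isHermitian G) +
      2 * (2 / Real.sqrt n * (1 - (p : ℝ) / 2)) * n) =
      matrixEnergy (rcwMatrix_isHermitian G) + 2 * (1 - (p : ℝ) / 2) * n := by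
    field_simp
  rw [e4] at e3
  have hn0 : (0 : ℝ) ≤ n := by positivity
  have hcn : 2 * (1 - (p : ℝ) / 2) * n ≤ 2 * n := by nlinarith
  rw [abs_le]
  constructor <;> linarith

theorem connected_and_energy_close {n : ℕ} (hn : 2 ≤ n) {p : unitInterval} {ε s : ℝ}
    (hn' : 4 ≤ ε * Real.sqrt n) {G : SimpleGraph (Fin n)}
    (hG : G ∈ commonNeighborGraphs (Fin n))
    (hE : |matrixEnergy (normalizedAdj_isHermitian (p : ℝ) G) / n - 8 / (3 * Real.pi) * s| ≤ ε) :
    G.Connected ∧ |matrixEnergy (rcwMatrix_isHermitian G) -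
      4 / (3 * Real.pi) * s * (n : ℝ) ^ (3 / 2 : ℝ)| ≤ ε * (n : ℝ) ^ (3 / 2 : ℝ) := by
  have : Nontrivial (Fin n) := Fin.nontrivial_iff_two_le.mpr hn
  refine ⟨connected_of_mem_commonNeighborGraphs hG, ?_⟩
  have hn0 : (0 : ℝ) < n := by exact_mod_cast (by omega : 0 < n)
  have hpow : (n : ℝ) ^ (3 / 2 : ℝ) = n * Real.sqrt n := by
    rw [Real.sqrt_eq_rpow, show (3 / 2 : ℝ) = 1 + 1 / 2 by norm_num, Real.rpow_add hn0,
      Real.rpow_one]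
  have h1 := abs_matrixEnergy_rcwMatrix_sub_le (p := p) hn hG
  set X := matrixEnergy (rcwMatrix_isHermitian G)
  set Y := matrixEnergy (normalizedAdj_isHermitian (p : ℝ) G)
  rw [hpow]
  have h2 : X - 4 / (3 * Real.pi) * s * (n * Real.sqrt n) =
      (X - Real.sqrt n / 2 * Y) +
        (n * Real.sqrt n / 2) * (Y / n - 8 / (3 * Real.pi) * s) := by
    field_simp
    ring
  rw [h2]
  refine (abs_add_le _ _).trans ?_
  rw [abs_mul, abs_of_nonneg (by positivity : 0 ≤ n * Real.sqrt n / 2)]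
  have h3 := mul_le_mul_of_nonneg_left hE (by positivity : 0 ≤ n * Real.sqrt n / 2)
  have h4 := mul_le_mul_of_nonneg_left hn' hn0.le
  linarith

end Convergence

theorem corollary3p4 (p : unitInterval) (hp0 : 0 < (p : ℝ)) (hp1 : (p : ℝ) < 1) :
    ∀ ε : ℝ, 0 < ε →
      Tendsto
        (fun n : ℕ => (SimpleGraph.binomialRandom (Fin n) p)
          {G : SimpleGraph (Fin n) | G.Connected ∧
            |matrixEnergy (rcwMatrix_isHermitian G)
                - 4 / (3 * Real.pi) * Real.sqrt ((p : ℝ) * (1 - (p : ℝ))) * (n : ℝ) ^ (3 / 2 : ℝ)|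
              ≤ ε * (n : ℝ) ^ (3 / 2 : ℝ)})
        atTop (𝓝 1) := by
  intro ε hε
  have h1 := tendsto_binomialRandom_real_compl_commonNeighborGraphs hp0 hp1
  have h2 := tendsto_binomialRandom_real_energy_deviation hp0 hp1 hε
  have h3 : Tendsto (fun n : ℕ => ENNReal.ofReal (1 -
      ((SimpleGraph.binomialRandom (Fin n) p).real (commonNeighborGraphs (Fin n))ᶜ +
      (SimpleGraph.binomialRandom (Fin n) p).real {G : SimpleGraph (Fin n) |
        ε < |matrixEnergy (normalizedAdj_isHermitian (p : ℝ) G) / n -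
          8 / (3 * Real.pi) * Real.sqrt ((p : ℝ) * (1 - p))|}))) atTop (𝓝 1) := by
    have := ENNReal.tendsto_ofReal ((h1.add h2).const_sub 1)
    simpa using this
  refine tendsto_of_tendsto_of_tendsto_of_le_of_le' h3 tendsto_const_nhds ?_
    (Eventually.of_forall fun n => prob_le_one)
  have hlarge : ∀ᶠ n : ℕ in atTop, 4 ≤ ε * Real.sqrt n :=
    (Tendsto.const_mul_atTop hε
      (Real.tendsto_sqrt_atTop.comp tendsto_natCast_atTop_atTop)).eventually_ge_atTop 4
  filter_upwards [eventually_ge_atTop 2, hlarge] with n hn hn'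
  rw [← ENNReal.ofReal_toReal (measure_ne_top (SimpleGraph.binomialRandom (Fin n) p) _)]
  refine ENNReal.ofReal_le_ofReal ?_
  rw [sub_le_iff_le_add, ← measureReal_def]
  have huniv : (SimpleGraph.binomialRandom (Fin n) p).real Set.univ = 1 := probReal_univ
  refine huniv.symm.le.trans <| (measureReal_mono ?_).trans ((measureReal_union_le _ _).trans
    (add_le_add_right (measureReal_union_le _ _) _))
  intro G _
  by_cases hG : G ∈ commonNeighborGraphs (Fin n)
  · by_cases hE : ε < |matrixEnergy (normalizedAdj_isHermitian (p : ℝ) G) / n -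
        8 / (3 * Real.pi) * Real.sqrt ((p : ℝ) * (1 - p))|
    · exact Or.inr (Or.inr hE)
    · exact Or.inl (connected_and_energy_close hn hn' hG (not_lt.mp hE))
  · exact Or.inr (Or.inl hG)
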